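/- Let $k\ge 1$. Work in the ring $\Lambda=\mathbb Q(t)[p_1,p_2,\dots]$ of symmetric functions over $\mathbb Q(t)$, where $p_i$ is the $i$-th power sum, $h_r$ the complete symmetric function ($h_r=0$ for $r<0$), $s_\lambda=\det(h_{\lambda_i-i+j})_{1\le i,j\le \ell(\lambda)}$ the Schur function, and $f^\perp$ is the adjoint of multiplication by $f$ for the Hall scalar product $\langle p_\lambda,p_\mu\rangle=\delta_{\lambda\mu}z_\lambda$. The notation $f[X(t-1)]$ means the image of $f$ under $p_i\mapsto (t^i-1)p_i$. Define: * for $\ell\in\mathbb Z$, the operator $B_\ell=\sum_{i\ge 0} h_{i+\ell}\, \bigl(h_i[X(t-1)]\bigr)^{\perp}$ on $\Lambda$; for a partition $\lambda$ of length $m$, $B_\lambda=\prod_{1\le i<j\le m}(1-t\,e_{ij})\,B_{\lambda_1}\cdots B_{\lambda_m}$, where $e_{ij}$ acts formally on products of operators by raising the $i$-th index by one and lowering the $j$-th index by one; * the Hall–Littlewood functions $H_\lambda[X;t]=B_{\lambda_1}\cdots B_{\lambda_{\ell}}\cdot 1$, where $\ell=\ell(\lambda)$, and $\Lambda^{(k)}_t$,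 the $\mathbb Q(t)$-span of the $H_\lambda[X;t]$ over the $k$-bounded partitions $\lambda$ (those with $\lambda_1\le k$); * the $k$-split $\lambda^{\to k}=(\lambda^{(1)},\dots,\lambda^{(r)})$ of a $k$-bounded $\lambda$: the sequence of nonempty partitions obtained by cutting $\lambda$ into consecutive pieces with $\lambda^{(i)}_1+\ell(\lambda^{(i)})-1=k$ for $i<r$ and $\lambda^{(r)}_1+\ell(\lambda^{(r)})-1\le k$; and the $k$-split polynomial $G^{(k)}_\lambda[X;t]=B_{\lambda^{(1)}}\cdots B_{\lambda^{(r)}}\cdot 1$; * for $j\ge 0$, the linear operator $\bar T^{(k)}_j$ on $\Lambda^{(k)}_t$ with $\bar T^{(k)}_jG^{(k)}_\lambda[X;t]=G^{(k)}_\lambda[X;t]$ if $\lambda_1=j$ and $0$ otherwise, for all $k$-bounded $\lambda$ (the $G_\lambda^{(k)}[X;t]$ form a basis of $\Lambda_t^{(k)}$, and $B_i$ preserves $\Lambda_t^{(k)}$ for $i\le k$); * the $k$-Schur functions, for $k$-bounded $\lambda$, by $s^{(k)}_{()}[X;t]=1$ and $s^{(k)}_\lambda[X;t]=\bar T^{(k)}_{\lambda_1}B_{\lambda_1}\,s^{(k)}_{(\lambda_2,\lambda_3,\dots)}[X;t]$.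 Then for every $k$-bounded partition $\lambda$, $$s_{\lambda}^{(k)}[X;t]= s_\lambda[X]+\sum_{\mu>\lambda} v_{\mu\lambda}^{(k)}(t)\,s_\mu[X],\qquad v_{\mu\lambda}^{(k)}(t)\in\mathbb Z[t],$$ where the sum is over the partitions $\mu$ of $|\lambda|$ that are strictly larger than $\lambda$ in dominance order. -/

import Mathlib

namespace KSchurFn

noncomputable section

/-! ### Symmetric functions

`Λ` is the ring of symmetric functions over `ℚ(t)`, as the polynomial ring `ℚ(t)[p₁, p₂, …]` in the
power sums (which are algebraically independent generators); the variable `X i` is `p_{i+1}`.  An exponent vector `m : ℕ →₀ ℕ` stands for the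
partition with `m i` parts equal to `i + 1`, and `monomial m 1` for the power sum product `p_m`. -/

/-- The coefficient field `ℚ(t)`. -/
abbrev K : Type := RatFunc ℚ

/-- The parameter `t`. -/
def t : K := RatFunc.X

/-- The ring of symmetric functions over `ℚ(t)`. -/
abbrev Λ : Type := MvPolynomial ℕ K

/-- Evaluation of a symmetric function in the variables `x₁, …, x_N`: the power sum `p_{i+1}`
goes to `∑ⱼ xⱼ ^ (i + 1)`. -/
def evalVars (N : ℕ) : Λ →ₐ[K] MvPolynomial (Fin N) K :=
  MvPolynomial.aeval fun i : ℕ => MvPolynomial.psum (Fin N) K (i + 1)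

/-- The complete symmetric function `h_n`, by Newton's recursion
`(n + 1) h_{n+1} = ∑_{i ≤ n} p_{i+1} h_{n-i}`; see `evalVars_h` for `h_n(x₁, …, x_N)`. -/
def h : ℕ → Λ
  | 0 => 1
  | n + 1 => ((n + 1 : K)⁻¹) • ∑ i : Fin (n + 1), MvPolynomial.X (i : ℕ) * h (n - i)

/-- `h_r` for an integer `r`, with `h_r = 0` for `r < 0`. -/
def hZ : ℤ → Λ
  | Int.ofNat n => h n
  | Int.negSucc _ => 0

/-- The Schur function of `l = (λ₁, …, λ_ℓ)`: the Jacobi-Trudi determinant `det (h_{λ_i - i + j})`. -/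
def schur (l : List ℕ) : Λ :=
  Matrix.det (Matrix.of fun i j : Fin l.length => hZ ((l.get i : ℤ) - (i : ℤ) + (j : ℤ)))

/-- `z_m = ∏ i ^ {m_i} m_i !` (the product over the part sizes `i`). -/
def z (m : ℕ →₀ ℕ) : K := m.prod fun i c => ((i : K) + 1) ^ c * (c.factorial : K)

/-- The Hall scalar product, `⟨p_λ, p_μ⟩ = δ_{λμ} z_λ`. -/
def hall : Λ →ₗ[K] Λ →ₗ[K] K :=
  (MvPolynomial.basisMonomials ℕ K).constr K fun a =>
    (MvPolynomial.basisMonomials ℕ K).constr K fun b => if a = b then z a else 0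

/-- `perp f` is the operator `f^⊥`, the adjoint of multiplication by `f` for the Hall scalar
product (`hall_perp`, `hall_nondegenerate`); on power sums
`p_a^⊥ p_m = (z_m / z_{m-a}) p_{m-a}` if `a ⊆ m`, and `0` otherwise. -/
def perp : Λ →ₗ[K] Λ →ₗ[K] Λ :=
  (MvPolynomial.basisMonomials ℕ K).constr K fun a =>
    (MvPolynomial.basisMonomials ℕ K).constr K fun m =>
      if a ≤ m then MvPolynomial.monomial (m - a) (z m / z (m - a)) else 0

/-- The plethysm `f ↦ f[X(t-1)]`, that is `p_i ↦ (t^i - 1) p_i`. -/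
def plethT : Λ →ₐ[K] Λ :=
  MvPolynomial.aeval fun i : ℕ => (t ^ (i + 1) - 1) • (MvPolynomial.X i : Λ)

/-! ### Vertex operators -/

/-- `B_ℓ = ∑_{i ≥ 0} s_{i+ℓ}[X] s_i[X(t-1)]^⊥` for `ℓ ∈ ℤ`, with `s_r = h_r`.
On each `f` only finitely many summands are nonzero (`finite_support_B`). -/
def B (l : ℤ) (f : Λ) : Λ := ∑ᶠ i : ℕ, hZ ((i : ℤ) + l) * perp (plethT (h i)) f

/-- The composite `B_{a₁} B_{a₂} ⋯ B_{a_m}`. -/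
def Bseq (a : List ℤ) (f : Λ) : Λ := a.foldr B f

/-- `B_λ = ∏_{i<j} (1 - t e_{ij}) B_{λ₁} ⋯ B_{λ_m}`, where `e_{ij}` raises the `i`-th index by one
and lowers the `j`-th by one, with the product expanded over the sets `E` of pairs `i < j`. -/
def Bpart (l : List ℕ) (f : Λ) : Λ :=
  ∑ E ∈ ((Finset.univ : Finset (Fin l.length × Fin l.length)).filter
      fun e => e.1 < e.2).powerset,
    ((-t) ^ E.card) • Bseq (List.ofFn fun r : Fin l.length =>
      (l.get r : ℤ) + ((E.filter fun e => e.1 = r).card : ℤ)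
        - ((E.filter fun e => e.2 = r).card : ℤ)) f

/-- The generalized Schur function product of a sequence of partitions,
`B_{λ^{(1)}} B_{λ^{(2)}} ⋯ 1`. -/
def genProd (S : List (List ℕ)) : Λ := S.foldr Bpart 1

/-- The modified Hall-Littlewood polynomial `H_λ[X;t] = B_{λ₁} ⋯ B_{λ_ℓ} 1`. -/
def hallLittlewood (l : List ℕ) : Λ := Bseq (l.map fun a => (a : ℤ)) 1

/-! ### Partitions -/

/-- A partition, as the weakly decreasing list of its nonzero parts. -/
def IsPartition (l : List ℕ) : Prop := l.Pairwise (· ≥ ·) ∧ ∀ a ∈ l, 0 < a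

/-- A `k`-bounded partition: all parts are at most `k`. -/
def IsBounded (k : ℕ) (l : List ℕ) : Prop := IsPartition l ∧ ∀ a ∈ l, a ≤ k

/-- The main hook-length of a nonempty partition, `λ₁ + ℓ(λ) - 1`. -/
def mainHook (l : List ℕ) : ℕ := l.headD 0 + l.length - 1

/-- The `k`-split of a `k`-bounded partition: a piece with first part `a` consists of `k - a + 1`
consecutive parts, so that its main hook-length is `k`; the last piece takes what is left. -/
def ksplit (k : ℕ) : List ℕ → List (List ℕ)
  | [] => []
  | a :: l => (a :: l.take (k - a)) :: ksplit k (l.drop (k - a))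
termination_by l => l.length
decreasing_by simp

/-- The strict dominance order `λ < μ` on partitions of the same degree. -/
def StrictDom (l m : List ℕ) : Prop :=
  l.sum = m.sum ∧ (∀ i, (l.take i).sum ≤ (m.take i).sum) ∧ l ≠ m

instance : DecidableRel StrictDom := fun _ _ => Classical.propDecidable _

/-- The finite set of all partitions of `n`. -/
def partitionsOf (n : ℕ) : Finset (List ℕ) :=
  (Finset.univ : Finset n.Partition).image fun p => p.parts.sort (· ≥ ·)

/-! ### `k`-split polynomials and `k`-Schur functions -/

/-- `Λ_t^{(k)}`, the span of the `H_λ[X;t]` over the `k`-bounded partitions `λ`. -/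
def ΛB (k : ℕ) : Submodule K Λ := Submodule.span K {f | ∃ l, IsBounded k l ∧ f = hallLittlewood l}

/-- The `k`-split polynomial `G_λ^{(k)}[X;t]`. -/
def kSplitPoly (k : ℕ) (l : List ℕ) : Λ := genProd (ksplit k l)

/-- The defining property of the projection `T_j^{(k)}` of `Λ_t^{(k)}`: it fixes `G_λ^{(k)}` if
`λ₁ = j` and kills it otherwise, for all `k`-bounded `λ` (with `λ₁ = 0` for the empty `λ`). -/
def IsProj (k j : ℕ) (T : ΛB k →ₗ[K] ΛB k) : Prop :=
  ∀ l, IsBounded k l → ∃ hG : kSplitPoly k l ∈ ΛB k,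
    T ⟨kSplitPoly k l, hG⟩ = if l.headD 0 = j then ⟨kSplitPoly k l, hG⟩ else 0

/-- The linear projection operator `T_j^{(k)}` on `Λ_t^{(k)}`: the operator with the defining property
`IsProj k j`, which determines it since the `G_λ^{(k)}` form a basis of `Λ_t^{(k)}`. -/
def proj (k j : ℕ) : ΛB k →ₗ[K] ΛB k := Classical.epsilon (IsProj k j)

open Classical in
/-- `T_j^{(k)}` applied to `f ∈ Λ_t^{(k)}` (the value outside `Λ_t^{(k)}` is a dummy). -/
def applyProj (k j : ℕ) (f : Λ) : Λ :=
  if hf : f ∈ ΛB k then (proj k j ⟨f, hf⟩ : Λ) else 0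

/-- The `k`-Schur function: `s_λ^{(k)} = T_{λ₁}^{(k)} B_{λ₁} s_{(λ₂, λ₃, …)}^{(k)}` and
`s_{()}^{(k)} = 1`. -/
def kSchur (k : ℕ) : List ℕ → Λ
  | [] => 1
  | a :: l => applyProj k a (B (a : ℤ) (kSchur k l))

/-! ### Basic facts confirming the definitions -/

theorem mem_partitionsOf (n : ℕ) (l : List ℕ) :
    l ∈ partitionsOf n ↔ IsPartition l ∧ l.sum = n := by
  unfold partitionsOf IsPartition
  simp only [Finset.mem_image, Finset.mem_univ, true_and]
  constructor
  · rintro ⟨p, rfl⟩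
    refine ⟨⟨Multiset.pairwise_sort _ _, fun a ha => p.parts_pos (by simpa using ha)⟩, ?_⟩
    have := p.parts_sum
    rwa [← Multiset.sort_eq p.parts (· ≥ ·), Multiset.sum_coe] at this
  · rintro ⟨⟨h1, h2⟩, h3⟩
    refine ⟨⟨(l : Multiset ℕ), fun {i} hi => h2 i (by simpa using hi), by simpa using h3⟩, ?_⟩
    simp only [Multiset.coe_sort]
    exact List.mergeSort_of_pairwise (by simpa using h1)

theorem ksplit_flatten (k : ℕ) (l : List ℕ) : (ksplit k l).flatten = l := by
  match l with
  | [] => simp [ksplit]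
  | a :: l => rw [ksplit]; simp [ksplit_flatten k (l.drop (k - a))]
termination_by l.length
decreasing_by simp

/-- Every piece of the `k`-split but the last has main hook-length `k`. -/
theorem ksplit_mainHook (k : ℕ) (l : List ℕ) (hl : ∀ a ∈ l, a ≤ k) :
    ∀ q ∈ (ksplit k l).dropLast, mainHook q = k := by
  match l with
  | [] => simp [ksplit]
  | a :: l =>
    have ha : a ≤ k := hl a (by simp)
    have ih := ksplit_mainHook k (l.drop (k - a))
      (fun c hc => hl c (List.mem_cons_of_mem _ (List.mem_of_mem_drop hc)))
    rcases hd : l.drop (k - a) with _ | ⟨b, m⟩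
    · rw [ksplit, hd]; simp [ksplit]
    · have hlen : k - a < l.length := by
        by_contra hcon
        rw [List.drop_eq_nil_of_le (by omega)] at hd
        simp at hd
      have hne : ksplit k (l.drop (k - a)) ≠ [] := by rw [hd, ksplit]; simp
      rw [ksplit, List.dropLast_cons_of_ne_nil hne]
      intro q hq
      rcases List.mem_cons.1 hq with rfl | hq
      · simp [mainHook]; omega
      · exact ih q hq
termination_by l.length
decreasing_by simp

/-- Every piece of the `k`-split is nonempty and has main hook-length at most `k`. -/
theorem ksplit_mainHook_le (k : ℕ) (l : List ℕ) (hl : ∀ a ∈ l, a ≤ k) :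
    ∀ q ∈ ksplit k l, q ≠ [] ∧ mainHook q ≤ k := by
  match l with
  | [] => simp [ksplit]
  | a :: l =>
    have ha : a ≤ k := hl a (by simp)
    have ih := ksplit_mainHook_le k (l.drop (k - a))
      (fun c hc => hl c (List.mem_cons_of_mem _ (List.mem_of_mem_drop hc)))
    rw [ksplit]
    intro q hq
    rcases List.mem_cons.1 hq with rfl | hq
    · simp [mainHook]; omega
    · exact ih q hq
termination_by l.length
decreasing_by simp

theorem z_ne_zero (m : ℕ →₀ ℕ) : z m ≠ 0 := by
  unfold z
  refine Finset.prod_ne_zero_iff.2 fun i _ => mul_ne_zero (pow_ne_zero _ ?_) ?_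
  · exact_mod_cast Nat.succ_ne_zero i
  · exact_mod_cast Nat.factorial_ne_zero _

theorem hall_monomial (a b : ℕ →₀ ℕ) :
    hall (MvPolynomial.monomial a 1) (MvPolynomial.monomial b 1) = if a = b then z a else 0 := by
  have e : ∀ s : ℕ →₀ ℕ, (MvPolynomial.monomial s 1 : Λ) = MvPolynomial.basisMonomials ℕ K s :=
    fun s => by simp
  rw [e, e]
  unfold hall
  rw [Module.Basis.constr_basis, Module.Basis.constr_basis]

theorem perp_monomial (a m : ℕ →₀ ℕ) :
    perp (MvPolynomial.monomial a 1) (MvPolynomial.monomial m 1) =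
      if a ≤ m then MvPolynomial.monomial (m - a) (z m / z (m - a)) else 0 := by
  have e : ∀ s : ℕ →₀ ℕ, (MvPolynomial.monomial s 1 : Λ) = MvPolynomial.basisMonomials ℕ K s :=
    fun s => by simp
  rw [e a, e m]
  unfold perp
  rw [Module.Basis.constr_basis, Module.Basis.constr_basis]

/-- `f^⊥` is adjoint to multiplication by `f`. -/
theorem hall_perp (f g u : Λ) : hall (perp f g) u = hall g (f * u) := by
  induction f using MvPolynomial.induction_on' with
  | add p q hp hq => simp [add_mul, hp, hq]
  | monomial a c =>
  induction g using MvPolynomial.induction_on' with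
  | add p q hp hq => simp [hp, hq]
  | monomial m d =>
  induction u using MvPolynomial.induction_on' with
  | add p q hp hq => simp [mul_add, hp, hq]
  | monomial b e =>
  have e1 : ∀ (s : ℕ →₀ ℕ) (r : K),
      (MvPolynomial.monomial s r : Λ) = r • MvPolynomial.monomial s 1 := by
    intro s r; simp [MvPolynomial.smul_monomial]
  rw [MvPolynomial.monomial_mul, e1 a, e1 m, e1 b, e1 (a + b)]
  simp only [map_smul, LinearMap.smul_apply, perp_monomial, hall_monomial, smul_eq_mul]
  by_cases ham : a ≤ m
  · rw [if_pos ham, e1 (m - a)]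
    simp only [map_smul, LinearMap.smul_apply, hall_monomial, smul_eq_mul]
    by_cases hb : m = a + b
    · subst hb
      have := z_ne_zero b
      simp; field_simp
    · have : m - a ≠ b := by
        rintro rfl; exact hb (add_tsub_cancel_of_le ham).symm
      simp [hb, this]
  · have : m ≠ a + b := by rintro rfl; exact ham (self_le_add_right a b)
    simp [ham, this]

theorem hall_nondegenerate (f : Λ) (hf : ∀ u, hall f u = 0) : f = 0 := by
  ext b
  have h1 : ∀ g : Λ, hall g (MvPolynomial.monomial b 1) = MvPolynomial.coeff b g * z b := by
    intro g
    induction g using MvPolynomial.induction_on' with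
    | add p q hp hq => simp [add_mul, hp, hq]
    | monomial a c =>
      have : (MvPolynomial.monomial a c : Λ) = c • MvPolynomial.monomial a 1 := by
        simp [MvPolynomial.smul_monomial]
      rw [this, map_smul, LinearMap.smul_apply, hall_monomial]
      by_cases hab : a = b
      · subst hab; simp
      · simp [hab]
  have h2 := h1 f
  rw [hf] at h2
  rcases mul_eq_zero.1 h2.symm with h3 | h3
  · simpa using h3
  · exact absurd h3 (z_ne_zero b)

theorem isWeightedHomogeneous_h (n : ℕ) :
    MvPolynomial.IsWeightedHomogeneous (fun i : ℕ => i + 1) (h n) n := by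
  induction n using Nat.strong_induction_on with
  | _ n ih =>
  cases n with
  | zero => rw [h]; exact MvPolynomial.isWeightedHomogeneous_one _ _
  | succ n =>
    rw [h, MvPolynomial.smul_eq_C_mul]
    suffices hs : MvPolynomial.IsWeightedHomogeneous (fun i : ℕ => i + 1)
        (∑ i : Fin (n + 1), (MvPolynomial.X (i : ℕ) : Λ) * h (n - i)) (n + 1) by
      have hc := (MvPolynomial.isWeightedHomogeneous_C (fun i : ℕ => i + 1) ((n : K) + 1)⁻¹).mul hs
      rwa [zero_add] at hc
    refine MvPolynomial.IsWeightedHomogeneous.sum _ _ _ fun i _ => ?_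
    have hc := (MvPolynomial.isWeightedHomogeneous_X K (fun i : ℕ => i + 1) (i : ℕ)).mul
      (ih (n - i) (by omega))
    have hd : ((i : ℕ) + 1) + (n - i) = n + 1 := by omega
    rwa [hd] at hc

theorem coeff_plethT_eq_zero (f : Λ) (a : ℕ →₀ ℕ) (ha : MvPolynomial.coeff a f = 0) :
    MvPolynomial.coeff a (plethT f) = 0 := by
  have key : ∀ g : Λ, ∃ c : K, MvPolynomial.coeff a (plethT g) = c * MvPolynomial.coeff a g := by
    refine fun g => ⟨a.prod fun i e => (t ^ (i + 1) - 1) ^ e, ?_⟩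
    induction g using MvPolynomial.induction_on' with
    | add p q hp hq => simp [mul_add, hp, hq]
    | monomial m c =>
      have : plethT (MvPolynomial.monomial m c) =
          MvPolynomial.monomial m (c * m.prod fun i e => (t ^ (i + 1) - 1) ^ e) := by
        unfold plethT
        rw [MvPolynomial.aeval_monomial, MvPolynomial.monomial_eq, MvPolynomial.algebraMap_eq]
        simp only [MvPolynomial.smul_eq_C_mul, Finsupp.prod, mul_pow,
          Finset.prod_mul_distrib, map_mul, map_prod, map_pow, mul_assoc]
      rw [this, MvPolynomial.coeff_monomial, MvPolynomial.coeff_monomial]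
      split_ifs with hm
      · subst hm; ring
      · simp
  obtain ⟨c, hc⟩ := key f
  rw [hc, ha, mul_zero]

/-- The sum that defines `B l f` has only finitely many nonzero terms. -/
theorem finite_support_B (l : ℤ) (f : Λ) :
    (Function.support fun i : ℕ => hZ ((i : ℤ) + l) * perp (plethT (h i)) f).Finite := by
  refine Set.Finite.subset
    (Set.finite_Iic (f.support.sup fun m => Finsupp.weight (fun i : ℕ => i + 1) m)) ?_
  intro i hi
  by_contra hcon
  simp only [Set.mem_Iic, not_le] at hcon
  refine hi ?_
  suffices hs : perp (plethT (h i)) f = 0 by simp [hs]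
  rw [(plethT (h i)).as_sum, map_sum, LinearMap.sum_apply]
  refine Finset.sum_eq_zero fun a ha => ?_
  rw [f.as_sum, map_sum]
  refine Finset.sum_eq_zero fun m hm => ?_
  have e1 : ∀ (s : ℕ →₀ ℕ) (r : K),
      (MvPolynomial.monomial s r : Λ) = r • MvPolynomial.monomial s 1 := by
    intro s r; simp [MvPolynomial.smul_monomial]
  rw [e1 a, e1 m]
  simp only [map_smul, LinearMap.smul_apply, perp_monomial]
  have hwa : Finsupp.weight (fun i : ℕ => i + 1) a = i := by
    refine isWeightedHomogeneous_h i ?_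
    intro h0
    exact (MvPolynomial.mem_support_iff.1 ha) (coeff_plethT_eq_zero _ _ h0)
  have hwm : Finsupp.weight (fun i : ℕ => i + 1) m < i :=
    lt_of_le_of_lt (Finset.le_sup (f := fun m => Finsupp.weight (fun i : ℕ => i + 1) m) hm) hcon
  have : ¬ a ≤ m := by
    intro ham
    have := congrArg (Finsupp.weight (fun i : ℕ => i + 1)) (add_tsub_cancel_of_le ham)
    rw [map_add, hwa] at this
    omega
  simp [this]

theorem coeff_hsymm (N n : ℕ) (m : Fin N →₀ ℕ) :
    MvPolynomial.coeff m (MvPolynomial.hsymm (Fin N) K n) = if m.degree = n then 1 else 0 := by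
  have hX : ∀ s : Multiset (Fin N), (s.map fun i => (MvPolynomial.X i : MvPolynomial (Fin N) K)).prod
      = MvPolynomial.monomial (Multiset.toFinsupp s) 1 := by
    intro s
    induction s using Multiset.induction with
    | empty => simp
    | cons a s ih =>
      rw [Multiset.map_cons, Multiset.prod_cons, ih, MvPolynomial.X, MvPolynomial.monomial_mul,
        ← Multiset.singleton_add, map_add, Multiset.toFinsupp_singleton, one_mul]
  unfold MvPolynomial.hsymm
  rw [MvPolynomial.coeff_sum]
  simp only [hX, MvPolynomial.coeff_monomial]
  split_ifs with hm
  · have hcard : (Finsupp.toMultiset m).card = n := by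
      rw [Finsupp.card_toMultiset, ← hm]; rfl
    refine (Fintype.sum_eq_single (Sym.mk (Finsupp.toMultiset m) hcard) ?_).trans ?_
    · intro s hs
      refine if_neg fun h0 => hs (Subtype.ext ?_)
      change s.1 = Finsupp.toMultiset m
      rw [← h0, Multiset.toFinsupp_toMultiset]
    · exact if_pos (Finsupp.toMultiset_toFinsupp m)
  · refine Finset.sum_eq_zero fun s _ => if_neg fun h0 => hm ?_
    have h2 := Multiset.toFinsupp_sum_eq s.1
    rw [h0] at h2
    exact h2.trans s.2

theorem hsymm_newton (N n : ℕ) :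
    ((n + 1 : ℕ) : K) • MvPolynomial.hsymm (Fin N) K (n + 1) =
      ∑ i : Fin (n + 1), MvPolynomial.psum (Fin N) K (i + 1) *
        MvPolynomial.hsymm (Fin N) K (n - i) := by
  ext m
  have h1 : ∀ (i : Fin (n + 1)) (j : Fin N),
      MvPolynomial.coeff m ((MvPolynomial.X j : MvPolynomial (Fin N) K) ^ ((i : ℕ) + 1) *
        MvPolynomial.hsymm (Fin N) K (n - i)) =
      if (i : ℕ) < m j ∧ m.degree = n + 1 then 1 else 0 := by
    intro i j
    rw [MvPolynomial.X_pow_eq_monomial, MvPolynomial.coeff_monomial_mul', one_mul, coeff_hsymm]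
    by_cases hij : (i : ℕ) < m j
    · have hle : Finsupp.single j ((i : ℕ) + 1) ≤ m := Finsupp.single_le_iff.2 hij
      have hdeg := congrArg Finsupp.degree (add_tsub_cancel_of_le hle)
      rw [map_add, Finsupp.degree_single] at hdeg
      rw [if_pos hle]
      have : (m - Finsupp.single j ((i : ℕ) + 1)).degree = n - i ↔ m.degree = n + 1 := by omega
      simp only [this, hij, true_and]
    · rw [if_neg (fun hle => hij (Finsupp.single_le_iff.1 hle))]
      simp [hij]
  rw [MvPolynomial.coeff_smul, coeff_hsymm, MvPolynomial.coeff_sum]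
  simp only [MvPolynomial.psum, Finset.sum_mul, MvPolynomial.coeff_sum, h1]
  by_cases hm : m.degree = n + 1
  · rw [Finset.sum_comm]
    have h2 : ∀ j : Fin N,
        (∑ i : Fin (n + 1), if (i : ℕ) < m j ∧ m.degree = n + 1 then (1 : K) else 0) = m j := by
      intro j
      have hj : m j ≤ n + 1 := hm ▸ Finsupp.le_degree j m
      simp only [hm, and_true]
      rw [Fin.sum_univ_eq_sum_range (fun i : ℕ => if i < m j then (1 : K) else 0),
        Finset.sum_boole]
      have : (Finset.range (n + 1)).filter (fun i => i < m j) = Finset.range (m j) := by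
        ext i; simp; omega
      rw [this, Finset.card_range]
    simp only [h2]
    rw [if_pos hm, ← Nat.cast_sum, ← hm, Finsupp.degree_eq_sum]
    simp
  · simp [hm]

/-- In the variables `x₁, …, x_N`, `h_n` is the sum of all monomials of degree `n`. -/
theorem evalVars_h (N n : ℕ) : evalVars N (h n) = MvPolynomial.hsymm (Fin N) K n := by
  induction n using Nat.strong_induction_on with
  | _ n ih =>
  cases n with
  | zero => rw [h, map_one, MvPolynomial.hsymm_zero]
  | succ n =>
    rw [h, map_smul, map_sum]
    have hn : ((n : K) + 1) ≠ 0 := by exact_mod_cast Nat.succ_ne_zero n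
    have := hsymm_newton N n
    push_cast at this
    rw [inv_smul_eq_iff₀ hn, this]
    refine Finset.sum_congr rfl fun i _ => ?_
    rw [map_mul, ih _ (by omega)]
    simp [evalVars]

end

end KSchurFn

namespace KSchurFn

noncomputable section

open Finset

/-! ### The operators `h_n[X(t-1)]^⊥` as coefficients of an algebra homomorphism -/

/-! Four families are compared by matrices that are unitriangular for dominance with entries in
`ℤ[t]`: the products `h_λ`, the Schur functions, the Hall–Littlewood functions `H_λ`, and the
`k`-split polynomials. Unitriangularity composes and inverts, so it is enough to link neighbouring
families.

Schur functions against `h_λ`: each non-identity term of the Jacobi–Trudi determinant is indexed by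
a strictly dominating sequence (`schur_sub_hprod`). `H_λ` against `h_λ`: moving `B_a` past a factor
`h_n` only transfers weight from `n` to `a` (`B_hZ_mul`, `HInt_sub_hprod`). `k`-split polynomials
against `H_λ`: expanding `B_q` raises indices, and since the main hook of each piece is at most `k`,
no index exceeds `k` (`raiseBy_le`).

The resulting integer sequences are brought back to partitions by `straighten`. For `H` it rests on
the quadratic relation `B_relation`; the rewriting goes up in dominance and keeps indices at most
`k`, so `H_λ` and the `k`-split polynomials are linked inside the `k`-bounded partitions.

The projection is diagonal with entries 0 and 1 in the `k`-split basis. By induction on the number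
of parts, applying `B_a` and then projecting keeps the leading term `H_λ` and an error supported
strictly above `λ` (`kSchur_sub_HInt`). Passing from `H` to Schur functions ends the proof. -/

/-- Both sides are adjoint to the same multiplication, and the Hall form is nondegenerate. -/
theorem perp_mul (f g u : Λ) : perp (f * g) u = perp f (perp g u) := by
  refine sub_eq_zero.1 (hall_nondegenerate _ fun v => ?_)
  rw [map_sub, LinearMap.sub_apply, hall_perp, hall_perp, hall_perp, sub_eq_zero]
  congr 1
  ring

theorem z_add_single (m : ℕ →₀ ℕ) (i : ℕ) :
    z (m + Finsupp.single i 1) = ((i : K) + 1) * ((m i : K) + 1) * z m := by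
  unfold z
  rw [← Finsupp.mul_prod_erase' (m + Finsupp.single i 1) i _ (by simp),
    ← Finsupp.mul_prod_erase' m i _ (by simp)]
  have : (m + Finsupp.single i 1).erase i = m.erase i := by
    rw [Finsupp.erase_add, Finsupp.erase_single, add_zero]
  rw [this]
  simp only [Finsupp.add_apply, Finsupp.single_eq_same, pow_succ, Nat.factorial_succ,
    Nat.cast_mul, Nat.cast_add, Nat.cast_one]
  ring

theorem perp_X (i : ℕ) (u : Λ) :
    perp (MvPolynomial.X i) u = ((i : K) + 1) • MvPolynomial.pderiv i u := by
  induction u using MvPolynomial.induction_on' with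
  | add p q hp hq => simp [hp, hq]
  | monomial m d =>
  have e1 : (MvPolynomial.monomial m d : Λ) = d • MvPolynomial.monomial m 1 := by
    simp [MvPolynomial.smul_monomial]
  rw [MvPolynomial.X, e1, map_smul, perp_monomial, Derivation.map_smul, MvPolynomial.pderiv_monomial,
    smul_comm]
  congr 1
  rw [MvPolynomial.smul_monomial, one_mul]
  split_ifs with hm
  · obtain ⟨m', rfl⟩ := exists_add_of_le hm
    rw [add_tsub_cancel_left, add_comm _ m', z_add_single]
    have := z_ne_zero m'
    congr 1
    simp only [Finsupp.add_apply, Finsupp.single_eq_same, Nat.cast_add, Nat.cast_one, smul_eq_mul]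
    field_simp
  · have : m i = 0 := by
      by_contra h0
      exact hm (Finsupp.single_le_iff.2 (Nat.one_le_iff_ne_zero.2 h0))
    simp [this]

theorem newton_h (n : ℕ) :
    ((n : K) + 1) • h (n + 1) = ∑ i ∈ range (n + 1), MvPolynomial.X i * h (n - i) := by
  have hn : ((n : K) + 1) ≠ 0 := by exact_mod_cast Nat.succ_ne_zero n
  rw [h, smul_inv_smul₀ hn, Fin.sum_univ_eq_sum_range (fun i => MvPolynomial.X i * h (n - i))]

/-- The translation `f ↦ f[X + (t-1) w]`, that is `p_i ↦ p_i + (t^i - 1) w^i`. -/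
def tau : Λ →ₐ[K] Polynomial Λ :=
  MvPolynomial.aeval fun i : ℕ =>
    Polynomial.C (MvPolynomial.X i) + (t ^ (i + 1) - 1) • (Polynomial.X : Polynomial Λ) ^ (i + 1)

theorem tau_X (i : ℕ) : tau (MvPolynomial.X i) =
    Polynomial.C (MvPolynomial.X i) + (t ^ (i + 1) - 1) • Polynomial.X ^ (i + 1) := by
  simp [tau]

/-- This is the chain rule in `w`. Only the variables occurring in `u` contribute, so any large
enough `s` serves; leaving `s` free lets the index sets be merged in the induction. -/
theorem derivative_tau (u : Λ) : ∃ s₀ : Finset ℕ, ∀ s, s₀ ⊆ s →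
    Polynomial.derivative (tau u) = ∑ i ∈ s, ((t ^ (i + 1) - 1) * ((i : K) + 1)) •
      (Polynomial.X ^ i * tau (MvPolynomial.pderiv i u)) := by
  induction u using MvPolynomial.induction_on with
  | C a =>
    refine ⟨∅, fun s _ => ?_⟩
    have : tau (MvPolynomial.C a) = Polynomial.C (MvPolynomial.C a) := tau.commutes a
    simp [this]
  | add p q hp hq =>
    obtain ⟨s₁, h₁⟩ := hp
    obtain ⟨s₂, h₂⟩ := hq
    refine ⟨s₁ ∪ s₂, fun s hs => ?_⟩
    rw [map_add, map_add, h₁ s (subset_union_left.trans hs), h₂ s (subset_union_right.trans hs),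
      ← sum_add_distrib]
    simp [mul_add]
  | mul_X p j hp =>
    obtain ⟨s₁, h₁⟩ := hp
    refine ⟨insert j s₁, fun s hs => ?_⟩
    have hj : j ∈ s := hs (mem_insert_self _ _)
    have hterm : ∀ i : ℕ, ((t ^ (i + 1) - 1) * ((i : K) + 1)) •
        ((Polynomial.X : Polynomial Λ) ^ i *
          tau (MvPolynomial.pderiv i (p * MvPolynomial.X j))) =
        ((t ^ (i + 1) - 1) * ((i : K) + 1)) •
          (Polynomial.X ^ i * tau (MvPolynomial.pderiv i p)) * tau (MvPolynomial.X j) +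
        if i = j then ((t ^ (i + 1) - 1) * ((i : K) + 1)) • (Polynomial.X ^ i * tau p) else 0 := by
      intro i
      rw [Derivation.leibniz, MvPolynomial.pderiv_X, smul_eq_mul, smul_eq_mul, map_add, map_mul,
        map_mul, mul_add (Polynomial.X ^ i), smul_add, add_comm, smul_mul_assoc, mul_assoc,
        mul_comm (tau (MvPolynomial.X j))]
      congr 1
      by_cases hij : i = j
      · subst hij; simp
      · simp [hij, Ne.symm hij]
    rw [sum_congr rfl fun i _ => hterm i, sum_add_distrib, ← sum_mul,
      ← h₁ s ((subset_insert _ _).trans hs), sum_ite_eq' s j, if_pos hj, map_mul,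
      Polynomial.derivative_mul]
    congr 1
    rw [tau_X, map_add, Polynomial.derivative_C, zero_add, Polynomial.derivative_smul,
      Polynomial.derivative_X_pow, mul_comm (tau p)]
    simp [Algebra.smul_def, Polynomial.algebraMap_apply, mul_assoc]

theorem coeff_tau_succ (u : Λ) (n : ℕ) :
    ((n : K) + 1) • (tau u).coeff (n + 1) = ∑ i ∈ range (n + 1),
      ((t ^ (i + 1) - 1) * ((i : K) + 1)) • (tau (MvPolynomial.pderiv i u)).coeff (n - i) := by
  obtain ⟨s₀, hs₀⟩ := derivative_tau u
  have h1 := congrArg (fun q : Polynomial Λ => q.coeff n)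
    (hs₀ (s₀ ∪ range (n + 1)) subset_union_left)
  simp only [Polynomial.coeff_derivative, Polynomial.finsetSum_coeff, Polynomial.coeff_smul,
    Polynomial.coeff_X_pow_mul'] at h1
  rw [← sum_subset (subset_union_right (s₁ := s₀) (s₂ := range (n + 1)))] at h1
  · rw [sum_congr rfl fun i hi => by
      rw [if_pos (Nat.lt_succ_iff.1 (mem_range.1 hi))]] at h1
    rw [← h1, mul_comm]
    simp [Algebra.smul_def]
  · intro i _ hi
    rw [if_neg (by simpa using hi), smul_zero]

/-- Newton's recursion for `h_n`, after `p_i ↦ (t^i - 1) p_i` and passage to adjoints, is the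
recursion `coeff_tau_succ` for the coefficients of `tau u`. The gain is that `tau` is
multiplicative. -/
theorem perp_plethT_h (n : ℕ) (u : Λ) : perp (plethT (h n)) u = (tau u).coeff n := by
  induction n using Nat.strong_induction_on generalizing u with
  | _ n ih =>
  cases n with
  | zero =>
    have h0 : perp (1 : Λ) u = u := by
      refine sub_eq_zero.1 (hall_nondegenerate _ fun v => ?_)
      rw [map_sub, LinearMap.sub_apply, hall_perp, one_mul, sub_self]
    have h1 : ((Polynomial.aeval (0 : Λ)).restrictScalars K).comp tau = AlgHom.id K Λ := by
      refine MvPolynomial.algHom_ext fun i => ?_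
      simp [tau_X, Algebra.smul_def]
    rw [h, map_one, h0, Polynomial.coeff_zero_eq_aeval_zero]
    exact (DFunLike.congr_fun h1 u).symm
  | succ n =>
    have hn : ((n : K) + 1) ≠ 0 := by exact_mod_cast Nat.succ_ne_zero n
    refine smul_right_injective _ hn ?_
    simp only
    rw [coeff_tau_succ, ← LinearMap.smul_apply, ← map_smul, ← map_smul, newton_h, map_sum, map_sum,
      LinearMap.sum_apply]
    refine sum_congr rfl fun i hi => ?_
    -- The adjoint of the power sum is made to act first, so that the induction hypothesis applies
    -- to the derivative of `u`.
    rw [map_mul, mul_comm, perp_mul]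
    have : plethT (MvPolynomial.X i) = (t ^ (i + 1) - 1) • MvPolynomial.X i := by simp [plethT]
    rw [this, map_smul, LinearMap.smul_apply, perp_X, map_smul, map_smul,
      ih (n - i) (by omega), mul_smul]

/-! ### Newton recursions -/

/-- The hypotheses say that the generating series satisfy `x' = P x` and `y' = Q y`, so Leibniz
gives `(xy)' = (P + Q) xy`. -/
theorem newton_conv {R : Type*} [CommRing R] {x y P Q : ℕ → R}
    (hx : ∀ n : ℕ, ((n : R) + 1) * x (n + 1) = ∑ p ∈ antidiagonal n, P p.1 * x p.2)
    (hy : ∀ n : ℕ, ((n : R) + 1) * y (n + 1) = ∑ p ∈ antidiagonal n, Q p.1 * y p.2) (n : ℕ) :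
    ((n : R) + 1) * ∑ p ∈ antidiagonal (n + 1), x p.1 * y p.2 =
      ∑ p ∈ antidiagonal n, (P p.1 + Q p.1) * ∑ q ∈ antidiagonal p.2, x q.1 * y q.2 := by
  have key : ∀ {x P : ℕ → R},
      (∀ n : ℕ, ((n : R) + 1) * x (n + 1) = ∑ p ∈ antidiagonal n, P p.1 * x p.2) →
      PowerSeries.derivative R (PowerSeries.mk x) = PowerSeries.mk P * PowerSeries.mk x := by
    intro x P hxP
    ext n
    rw [PowerSeries.coeff_derivative, PowerSeries.coeff_mul, PowerSeries.coeff_mk, mul_comm, hxP]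
    simp
  have h1 : PowerSeries.derivative R (PowerSeries.mk x * PowerSeries.mk y) =
      (PowerSeries.mk P + PowerSeries.mk Q) * (PowerSeries.mk x * PowerSeries.mk y) := by
    rw [Derivation.leibniz, key hx, key hy, smul_eq_mul, smul_eq_mul]
    ring
  have h2 := congrArg (PowerSeries.coeff n) h1
  rw [PowerSeries.coeff_derivative, PowerSeries.coeff_mul, PowerSeries.coeff_mul, mul_comm] at h2
  simpa [PowerSeries.coeff_mul] using h2

theorem newton_unique {R : Type*} [CommRing R] [IsDomain R] [CharZero R] {x y P : ℕ → R}
    (h0 : x 0 = y 0)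
    (hx : ∀ n : ℕ, ((n : R) + 1) * x (n + 1) = ∑ p ∈ antidiagonal n, P p.1 * x p.2)
    (hy : ∀ n : ℕ, ((n : R) + 1) * y (n + 1) = ∑ p ∈ antidiagonal n, P p.1 * y p.2) (n : ℕ) :
    x n = y n := by
  induction n using Nat.strong_induction_on with
  | _ n ih =>
  cases n with
  | zero => exact h0
  | succ n =>
    have hn : ((n : R) + 1) ≠ 0 := by exact_mod_cast Nat.succ_ne_zero n
    refine mul_left_cancel₀ hn ?_
    rw [hx, hy]
    refine sum_congr rfl fun p hp => ?_
    rw [ih p.2 (by have := mem_antidiagonal.1 hp; omega)]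

/-- The specialization `h_n[t-1]`. -/
def hsub : ℕ → K
  | 0 => 1
  | n + 1 => t ^ (n + 1) - t ^ n

theorem hsub_zero : hsub 0 = 1 := rfl

theorem hsub_succ (n : ℕ) : hsub (n + 1) = t ^ (n + 1) - t ^ n := rfl

/-- The generating series of `hsub` is `(1 - w)/(1 - tw)`, whose logarithmic derivative has
coefficients `t^(i+1) - 1`. The two sums obtained by splitting that factor have closed forms. -/
theorem newton_hsub (n : ℕ) :
    ((n : K) + 1) * hsub (n + 1) =
      ∑ p ∈ antidiagonal n, (t ^ (p.1 + 1) - 1) * hsub p.2 := by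
  have tel : ∀ n : ℕ, ∑ p ∈ antidiagonal n, hsub p.2 = t ^ n := by
    intro n
    induction n with
    | zero => simp [hsub_zero]
    | succ n ih => rw [Nat.antidiagonal_succ, sum_cons, sum_map]; simp [ih, hsub_succ]
  have tel2 : ∀ n : ℕ, ∑ p ∈ antidiagonal n, t ^ (p.1 + 1) * hsub p.2 =
      ((n : K) + 1) * t ^ (n + 1) - n * t ^ n := by
    intro n
    induction n with
    | zero => simp [hsub_zero]
    | succ n ih =>
      rw [Nat.antidiagonal_succ, sum_cons, sum_map]
      have : ∀ p : ℕ × ℕ, t ^ (p.1 + 1 + 1) * hsub p.2 = t * (t ^ (p.1 + 1) * hsub p.2) :=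
        fun p => by ring
      simp only [Function.Embedding.prodMap, Function.Embedding.coeFn_mk, Prod.map,
        Function.Embedding.refl_apply, this, Nat.succ_eq_add_one]
      rw [← mul_sum, ih, hsub_succ]
      push_cast
      ring
  simp only [sub_mul, one_mul, sum_sub_distrib, tel, tel2, hsub_succ]
  ring

/-- The addition formula for `h_n[X + (t-1)w]`: both sides obey the Newton recursion for the sum of
the two alphabets. -/
theorem tau_h (n : ℕ) : tau (h n) = ∑ p ∈ antidiagonal n,
    (hsub p.1 • (Polynomial.X : Polynomial Λ) ^ p.1) * Polynomial.C (h p.2) := by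
  have h0 : tau (h 0) = ∑ p ∈ antidiagonal 0,
      (hsub p.1 • (Polynomial.X : Polynomial Λ) ^ p.1) * Polynomial.C (h p.2) := by
    simp [h, hsub_zero]
  refine newton_unique (R := Polynomial Λ)
    (P := fun i => (t ^ (i + 1) - 1) • (Polynomial.X : Polynomial Λ) ^ (i + 1) +
      Polynomial.C (MvPolynomial.X i)) (x := fun n => tau (h n))
    (y := fun n => ∑ p ∈ antidiagonal n,
      (hsub p.1 • (Polynomial.X : Polynomial Λ) ^ p.1) * Polynomial.C (h p.2)) h0 (fun n => ?_)
    (newton_conv (x := fun n => hsub n • (Polynomial.X : Polynomial Λ) ^ n)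
      (y := fun n => Polynomial.C (h n))
      (P := fun i => (t ^ (i + 1) - 1) • (Polynomial.X : Polynomial Λ) ^ (i + 1))
      (Q := fun i => Polynomial.C (MvPolynomial.X i)) (fun n => ?_) fun n => ?_) n
  · have := congrArg tau (newton_h n)
    rw [map_smul, map_sum] at this
    rw [Nat.sum_antidiagonal_eq_sum_range_succ_mk]
    simp only [map_mul, tau_X] at this
    rw [Algebra.smul_def] at this
    simpa [add_comm] using this
  · have := newton_hsub n
    have h2 : ∀ p ∈ antidiagonal n, ((t ^ (p.1 + 1) - 1) • (Polynomial.X : Polynomial Λ) ^ (p.1 + 1)) *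
        (hsub p.2 • (Polynomial.X : Polynomial Λ) ^ p.2) =
        ((t ^ (p.1 + 1) - 1) * hsub p.2) • Polynomial.X ^ (n + 1) := by
      intro p hp
      rw [smul_mul_smul_comm, ← pow_add, ← mem_antidiagonal.1 hp]
      congr 2
      omega
    rw [sum_congr rfl h2, ← sum_smul, ← this, mul_smul, Algebra.smul_def ((n : K) + 1)]
    simp
  · have := congrArg (Polynomial.C : Λ → Polynomial Λ) (newton_h n)
    rw [map_sum] at this
    rw [Nat.sum_antidiagonal_eq_sum_range_succ_mk]
    rw [Algebra.smul_def] at this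
    simpa using this

theorem hZ_natCast (n : ℕ) : hZ (n : ℤ) = h n := rfl

theorem hZ_of_neg {n : ℤ} (hn : n < 0) : hZ n = 0 := by
  obtain ⟨m, rfl⟩ := Int.eq_negSucc_of_lt_zero hn
  rfl

theorem hZ_zero : hZ 0 = 1 := by
  change h 0 = 1
  rw [h]

/-- Terms past `n` vanish because `h_r = 0` for `r < 0`. The free cutoff `P` allows one range for
many values of `n`. -/
theorem tau_hZ (n : ℤ) (P : ℕ) (hP : n < P) : tau (hZ n) = ∑ p ∈ range P,
    (hsub p • (Polynomial.X : Polynomial Λ) ^ p) * Polynomial.C (hZ (n - p)) := by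
  rcases lt_or_ge n 0 with hn | hn
  · rw [hZ_of_neg hn, map_zero]
    refine (sum_eq_zero fun p _ => ?_).symm
    rw [hZ_of_neg (by omega), map_zero, mul_zero]
  · obtain ⟨m, rfl⟩ := Int.eq_ofNat_of_zero_le hn
    rw [hZ_natCast, tau_h, Nat.sum_antidiagonal_eq_sum_range_succ_mk]
    rw [← sum_subset (s₁ := range m.succ) (s₂ := range P) (by intro x; simp only [mem_range]; omega)]
    · refine sum_congr rfl fun p hp => ?_
      have : ((m : ℤ) - p) = ((m - p : ℕ) : ℤ) := by
        have := mem_range.1 hp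
        omega
      rw [this, hZ_natCast]
    · intro p _ hp
      rw [hZ_of_neg (by simp at hp; omega), map_zero, mul_zero]

/-! ### The operators `B_a` -/

/-- The `Λ`-linear map `w^i ↦ h_{a+i}`. -/
def toH (a : ℤ) : Polynomial Λ →ₗ[Λ] Λ :=
  Polynomial.lsum fun i => LinearMap.toSpanSingleton Λ Λ (hZ ((i : ℤ) + a))

theorem toH_monomial (a : ℤ) (i : ℕ) (c : Λ) :
    toH a (Polynomial.monomial i c) = c * hZ ((i : ℤ) + a) := by
  simp [toH, Polynomial.lsum_apply]

theorem toH_X_pow_mul (a : ℤ) (p : ℕ) (G : Polynomial Λ) :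
    toH a (Polynomial.X ^ p * G) = toH (a + p) G := by
  induction G using Polynomial.induction_on' with
  | add f g hf hg => rw [mul_add, map_add, map_add, hf, hg]
  | monomial n c =>
    rw [Polynomial.X_pow_mul_monomial, toH_monomial, toH_monomial]
    congr 2
    push_cast
    ring

theorem B_eq_toH (a : ℤ) (f : Λ) : B a f = toH a (tau f) := by
  unfold B
  simp only [perp_plethT_h]
  rw [finsum_eq_sum_of_support_subset (s := (tau f).support)]
  · rw [toH, Polynomial.lsum_apply, Polynomial.sum]
    refine sum_congr rfl fun i _ => ?_
    simp [mul_comm]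
  · intro i hi
    simp only [mem_coe, Polynomial.mem_support_iff]
    intro h0
    exact hi (by simp [h0])

/-- `B_a` as a linear map. -/
def BLin (a : ℤ) : Λ →ₗ[K] Λ := (toH a).restrictScalars K ∘ₗ tau.toLinearMap

theorem BLin_apply (a : ℤ) (f : Λ) : BLin a f = B a f := (B_eq_toH a f).symm

theorem B_one (a : ℤ) : B a 1 = hZ a := by
  rw [B_eq_toH, map_one, ← Polynomial.monomial_zero_one, toH_monomial]
  simp

/-- Since `tau` is multiplicative, `h_n` contributes the factor `tau (h_n)`, and each power `w^p` in
it raises the index of `B` by `p`. -/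
theorem B_hZ_mul (a n : ℤ) (P : ℕ) (hP : n < P) (g : Λ) :
    B a (hZ n * g) = ∑ p ∈ range P, hsub p • (hZ (n - p) * B (a + p) g) := by
  rw [B_eq_toH, map_mul, tau_hZ n P hP, sum_mul, map_sum]
  refine sum_congr rfl fun p _ => ?_
  have : (hsub p • (Polynomial.X : Polynomial Λ) ^ p * Polynomial.C (hZ (n - p))) * tau g =
      (MvPolynomial.C (hsub p) * hZ (n - p) : Λ) • (Polynomial.X ^ p * tau g) := by
    rw [Polynomial.smul_eq_C_mul, Algebra.smul_def, map_mul, Polynomial.algebraMap_apply,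
      MvPolynomial.algebraMap_eq]
    ring
  rw [this, map_smul, toH_X_pow_mul, B_eq_toH, smul_eq_mul, MvPolynomial.smul_eq_C_mul, mul_assoc]

/-- With `N a b` the normally ordered product, `B_a B_b - t B_{a+1} B_{b-1} = N a b - N (a+1)
(b-1)`. As `N` is symmetric, the right side changes sign under `(a, b) ↦ (b-1, a+1)`; adding the two
instances gives the relation. -/
theorem B_relation (i j : ℤ) (f : Λ) : B i (B j f) =
    t • B (i + 1) (B (j - 1) f) + t • B j (B i f) - B (j - 1) (B (i + 1) f) := by
  obtain ⟨D, hD⟩ : ∃ D : ℕ, ∀ q, D ≤ q → perp (plethT (h q)) f = 0 :=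
    ⟨(tau f).natDegree + 1, fun q hq => by
      rw [perp_plethT_h]; exact Polynomial.coeff_eq_zero_of_natDegree_lt (by omega)⟩
  have hcomm : ∀ p q, perp (plethT (h p)) (perp (plethT (h q)) f) =
      perp (plethT (h q)) (perp (plethT (h p)) f) := fun p q => by
    rw [← perp_mul, mul_comm, perp_mul]
  have hB : ∀ (a : ℤ) (g : Λ), (∀ q, D ≤ q → perp (plethT (h q)) g = 0) →
      B a g = ∑ q ∈ range D, hZ ((q : ℤ) + a) * perp (plethT (h q)) g := by
    intro a g hg
    unfold B
    refine finsum_eq_sum_of_support_subset _ fun q hq => ?_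
    simp only [coe_range, Set.mem_Iio]
    by_contra hcon
    exact hq (by simp [hg q (by omega)])
  -- Normal ordering: all multiplications by complete functions stand to the left of all adjoints.
  -- The cutoff `D` makes the sums finite.
  obtain ⟨N, hN₀⟩ : ∃ N : ℤ → ℤ → Λ, ∀ a b, N a b =
      ∑ q ∈ range D, hZ ((q : ℤ) + b) * B a (perp (plethT (h q)) f) := ⟨_, fun _ _ => rfl⟩
  have hN : ∀ a b, N a b = ∑ q ∈ range D, ∑ r ∈ range D,
      hZ ((q : ℤ) + b) * (hZ ((r : ℤ) + a) * perp (plethT (h r)) (perp (plethT (h q)) f)) := by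
    intro a b
    rw [hN₀]
    refine sum_congr rfl fun q _ => ?_
    rw [hB a _ fun r hr => by rw [hcomm, hD r hr, map_zero], mul_sum]
  have hNsymm : ∀ a b, N a b = N b a := by
    intro a b
    rw [hN, hN, sum_comm]
    refine sum_congr rfl fun q _ => sum_congr rfl fun r _ => ?_
    rw [hcomm q r]
    ring
  have hBB : ∀ (a b : ℤ) (P : ℕ), b + D < P →
      B a (B b f) = ∑ p ∈ range P, hsub p • N (a + p) (b - p) := by
    intro a b P hP
    rw [hB b f hD, ← BLin_apply, map_sum]
    simp only [hN₀, smul_sum]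
    rw [sum_comm]
    refine sum_congr rfl fun q hq => ?_
    have := mem_range.1 hq
    rw [BLin_apply, B_hZ_mul a _ P (by omega)]
    refine sum_congr rfl fun p _ => ?_
    rw [add_sub_assoc]
  have hdiff : ∀ a b : ℤ, B a (B b f) - t • B (a + 1) (B (b - 1) f) = N a b - N (a + 1) (b - 1) := by
    intro a b
    have hP : b + D < ((b + D).toNat + 1 : ℕ) := by push_cast; omega
    -- The first sum gets one term more than the second, so that its term `p + 2` meets the term `p
    -- + 1` of the other. These cancel because `hsub (p+2) = t * hsub (p+1)`; only the lowest terms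
    -- remain.
    rw [hBB a b ((b + D).toNat + 1 + 1) (by push_cast at hP ⊢; omega),
      hBB (a + 1) (b - 1) ((b + D).toNat + 1) (by omega), sum_range_succ', sum_range_succ',
      sum_range_succ']
    have hz : ∀ p ∈ range (b + D).toNat,
        hsub (p + 1 + 1) • N (a + ((p + 1 + 1 : ℕ) : ℤ)) (b - ((p + 1 + 1 : ℕ) : ℤ)) -
          t • hsub (p + 1) • N (a + 1 + ((p + 1 : ℕ) : ℤ)) (b - 1 - ((p + 1 : ℕ) : ℤ)) = 0 := by
      intro p _
      have e1 : a + ((p + 1 + 1 : ℕ) : ℤ) = a + 1 + ((p + 1 : ℕ) : ℤ) := by push_cast; ring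
      have e2 : b - ((p + 1 + 1 : ℕ) : ℤ) = b - 1 - ((p + 1 : ℕ) : ℤ) := by push_cast; ring
      rw [e1, e2, smul_smul, ← sub_smul]
      rw [show hsub (p + 1 + 1) - t * hsub (p + 1) = 0 by rw [hsub_succ, hsub_succ]; ring,
        zero_smul]
    have hz' := sum_eq_zero hz
    rw [sum_sub_distrib, ← smul_sum, sub_eq_zero] at hz'
    rw [hz']
    simp only [hsub_zero, hsub_succ, zero_add, Nat.cast_one, Nat.cast_zero, add_zero, sub_zero,
      pow_one, pow_zero, one_smul, sub_smul, smul_add]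
    abel
  have h1 := hdiff i j
  have h2 := hdiff (j - 1) (i + 1)
  rw [sub_add_cancel, add_sub_cancel_right, hNsymm (j - 1), hNsymm j i] at h2
  have h3 := congrArg₂ (· + ·) h1 h2
  simp only [sub_add_sub_cancel, sub_self] at h3
  rw [← sub_eq_zero, ← h3]
  abel

/-! ### Dominance order on integer sequences -/

/-- The weak dominance preorder `a ≤ b` on integer sequences, padded by zeros. -/
def Dom (a b : List ℤ) : Prop :=
  a.sum = b.sum ∧ ∀ i, (a.take i).sum ≤ (b.take i).sum

/-- The strict part of the dominance preorder. -/
def SDom (a b : List ℤ) : Prop := Dom a b ∧ ¬ Dom b a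

theorem Dom.refl (a : List ℤ) : Dom a a := ⟨rfl, fun _ => le_rfl⟩

theorem Dom.trans {a b c : List ℤ} (h₁ : Dom a b) (h₂ : Dom b c) : Dom a c :=
  ⟨h₁.1.trans h₂.1, fun i => (h₁.2 i).trans (h₂.2 i)⟩

theorem SDom.trans_dom {a b c : List ℤ} (h₁ : SDom a b) (h₂ : Dom b c) : SDom a c :=
  ⟨h₁.1.trans h₂, fun h => h₁.2 (h₂.trans h)⟩

theorem dom_append_iff {u u' w w' : List ℤ} (hlen : u.length = u'.length) (hsum : u.sum = u'.sum) :
    Dom (u ++ w) (u' ++ w') ↔ Dom u u' ∧ Dom w w' := by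
  constructor
  · rintro ⟨h1, h2⟩
    refine ⟨⟨hsum, fun i => ?_⟩, ?_, fun i => ?_⟩
    · have h3 := h2 (min i u.length)
      rw [List.take_append_of_le_length (min_le_right _ _),
        List.take_append_of_le_length (hlen ▸ min_le_right _ _)] at h3
      rw [← List.take_eq_take_min, hlen, ← List.take_eq_take_min] at h3
      exact h3
    · simpa [hsum] using h1
    · have h3 := h2 (u.length + i)
      rw [List.take_length_add_append] at h3
      rw [hlen, List.take_length_add_append] at h3
      simpa [hsum] using h3
  · rintro ⟨h1, h2⟩
    refine ⟨by simp [hsum, h2.1], fun i => ?_⟩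
    rw [List.take_append, List.take_append, List.sum_append, List.sum_append, hlen]
    exact add_le_add (h1.2 i) (h2.2 _)

theorem Dom.append_left {w w' : List ℤ} (u : List ℤ) (h : Dom w w') : Dom (u ++ w) (u ++ w') :=
  (dom_append_iff rfl rfl).2 ⟨Dom.refl u, h⟩

theorem SDom.cons {w w' : List ℤ} (a : ℤ) (h : SDom w w') : SDom (a :: w) (a :: w') :=
  ⟨h.1.append_left [a], fun h' => h.2 ((dom_append_iff (u := [a]) (u' := [a]) rfl rfl).1 h').2⟩

theorem dom_swap {i j x y : ℤ} (hs : x + y = i + j) (hx : i ≤ x) (v : List ℤ) :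
    Dom (i :: j :: v) (x :: y :: v) := by
  refine ⟨by simp only [List.sum_cons]; omega, fun n => ?_⟩
  match n with
  | 0 => simp
  | 1 => simpa using hx
  | n + 2 => simp only [List.take_succ_cons, List.sum_cons]; omega

theorem dom_append_zero (u : List ℤ) : Dom (u ++ [0]) u := by
  refine ⟨by simp, fun i => ?_⟩
  rw [List.take_append, List.sum_append]
  rcases i - u.length with _ | n <;> simp

/-- The sum of all partial sums, which is strictly monotone for dominance. -/
def sumPartial : List ℤ → ℤ
  | [] => 0
  | a :: l => (l.length + 1) * a + sumPartial l

theorem sumPartial_append (u w : List ℤ) :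
    sumPartial (u ++ w) = sumPartial u + w.length * u.sum + sumPartial w := by
  induction u with
  | nil => simp [sumPartial]
  | cons a u ih =>
    simp only [List.cons_append, sumPartial, ih, List.length_append, List.sum_cons]
    push_cast
    ring

/-- A crude upper bound, valid with negative entries too; it makes the straightening terminate. -/
theorem sumPartial_le (k : ℕ) (l : List ℤ) (hl : ∀ a ∈ l, a ≤ k) :
    sumPartial l ≤ k * l.length * l.length := by
  induction l with
  | nil => simp [sumPartial]
  | cons a l ih =>
    have h1 := ih fun b hb => hl b (List.mem_cons_of_mem _ hb)
    have h2 := mul_le_mul_of_nonneg_left (hl a List.mem_cons_self)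
      (by positivity : (0 : ℤ) ≤ l.length + 1)
    simp only [sumPartial, List.length_cons]
    push_cast
    have h3 : (0 : ℤ) ≤ k * l.length := by positivity
    nlinarith

theorem exists_ascent (l : List ℤ) (hl : ¬ l.Pairwise (· ≥ ·)) :
    ∃ u i j v, l = u ++ i :: j :: v ∧ i < j := by
  induction l with
  | nil => simp at hl
  | cons a l ih =>
    by_cases hp : l.Pairwise (· ≥ ·)
    · cases l with
      | nil => simp at hl
      | cons b w =>
        refine ⟨[], a, b, w, rfl, ?_⟩
        by_contra hcon
        refine hl (List.pairwise_cons.2 ⟨fun c hc => ?_, hp⟩)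
        rcases List.mem_cons.1 hc with rfl | hc
        · exact not_lt.1 hcon
        · exact ((List.pairwise_cons.1 hp).1 c hc).trans (not_lt.1 hcon)
    · obtain ⟨u, i, j, v, rfl, hij⟩ := ih hp
      exact ⟨a :: u, i, j, v, rfl, hij⟩

/-- A partition as a sequence of integers. -/
def toInts (l : List ℕ) : List ℤ := l.map Nat.cast

theorem span_image_le {R M ι : Type*} [Semiring R] [AddCommMonoid M] [Module R M] {F : ι → M}
    {S : Set ι} {N : Submodule R M} (hS : ∀ i ∈ S, F i ∈ N) {x : M}
    (hx : x ∈ Submodule.span R (F '' S)) : x ∈ N :=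
  Submodule.span_le.2 (Set.image_subset_iff.2 hS) hx

/-- A function of integer sequences which satisfies a two-term straightening rule is, at any
sequence bounded by `k`, a combination of its values at the dominating `k`-bounded partitions. -/
theorem straighten {R M : Type*} [Semiring R] [AddCommMonoid M] [Module R M] (F : List ℤ → M)
    (hneg : ∀ u a, a < 0 → F (u ++ [a]) = 0) (hzero : ∀ u, F (u ++ [0]) = F u)
    (hswap : ∀ u i j v, i < j → F (u ++ i :: j :: v) ∈ Submodule.span R
      (F '' {b | ∃ x y, x + y = i + j ∧ i < x ∧ x ≤ j ∧ b = u ++ x :: y :: v}))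
    (k : ℕ) (a : List ℤ) (ha : ∀ c ∈ a, c ≤ k) :
    F a ∈ Submodule.span R
      ((fun l => F (toInts l)) '' {l | IsBounded k l ∧ Dom a (toInts l)}) := by
  -- The outer induction absorbs the deletion of trailing zeros. The inner one is on the gap between
  -- `sumPartial a` and its bound, which shrinks at each rewriting of an ascent.
  induction hn : a.length using Nat.strong_induction_on generalizing a with
  | _ n ihn =>
  induction hN : (k * a.length * a.length - sumPartial a).toNat using Nat.strong_induction_on
    generalizing a with
  | _ N ihN =>
  by_cases hp : a.Pairwise (· ≥ ·)
  -- In a weakly decreasing sequence the last entry decides: negative gives zero, zero is dropped,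
  -- positive means a partition.
  · rcases List.eq_nil_or_concat' a with rfl | ⟨u, c, rfl⟩
    · exact Submodule.subset_span ⟨[], ⟨⟨⟨by simp, by simp⟩, by simp⟩, Dom.refl []⟩, rfl⟩
    rcases lt_trichotomy c 0 with hc | rfl | hc
    · rw [hneg u c hc]
      exact zero_mem _
    · rw [hzero u]
      refine span_image_le (fun l hl => ?_)
        (ihn u.length (by simp at hn; omega) u (fun c hc => ha c (by simp [hc])) rfl)
      exact Submodule.subset_span ⟨l, ⟨hl.1, (dom_append_zero u).trans hl.2⟩, rfl⟩
    · have hpos : ∀ b ∈ u ++ [c], 0 < b := by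
        intro b hb
        rcases List.mem_append.1 hb with hb | hb
        · exact hc.trans_le ((List.pairwise_append.1 hp).2.2 b hb c (by simp))
        · rw [List.mem_singleton.1 hb]; exact hc
      have hcast : toInts ((u ++ [c]).map Int.toNat) = u ++ [c] := by
        unfold toInts
        rw [List.map_map]
        conv_rhs => rw [← List.map_id (u ++ [c])]
        refine List.map_congr_left fun b hb => ?_
        exact Int.toNat_of_nonneg (hpos b hb).le
      refine Submodule.subset_span ⟨(u ++ [c]).map Int.toNat, ⟨⟨⟨?_, ?_⟩, ?_⟩, ?_⟩, ?_⟩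
      · exact hp.map _ fun x y hxy => Int.toNat_le_toNat hxy
      · intro b hb
        obtain ⟨b', hb', rfl⟩ := List.mem_map.1 hb
        have := hpos b' hb'
        omega
      · intro b hb
        obtain ⟨b', hb', rfl⟩ := List.mem_map.1 hb
        have := ha b' hb'
        omega
      · rw [hcast]; exact Dom.refl _
      · simp only [hcast]
  · obtain ⟨u, i, j, v, rfl, hij⟩ := exists_ascent a hp
    refine span_image_le ?_ (hswap u i j v hij)
    rintro b ⟨x, y, hs, hix, hxj, rfl⟩
    -- From `i < x ≤ j` and `x + y = i + j` both new entries are at most `j`, so the bound `k`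
    -- survives.
    have hb : ∀ c ∈ u ++ x :: y :: v, c ≤ k := by
      intro c hc
      have hj : j ≤ k := ha j (by simp)
      simp only [List.mem_append, List.mem_cons] at hc
      rcases hc with hc | rfl | rfl | hc
      · exact ha c (by simp [hc])
      · omega
      · omega
      · exact ha c (by simp [hc])
    have hlen : (u ++ x :: y :: v).length = (u ++ i :: j :: v).length := by simp
    refine span_image_le (fun l hl => ?_) (ihN _ ?_ _ hb (hlen.trans hn) rfl)
    · exact Submodule.subset_span
        ⟨l, ⟨hl.1, ((dom_swap hs hix.le v).append_left u).trans hl.2⟩, rfl⟩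
    · have h1 := sumPartial_le k _ hb
      have h2 : sumPartial (u ++ i :: j :: v) < sumPartial (u ++ x :: y :: v) := by
        have hy : y = i + j - x := by omega
        subst hy
        simp only [sumPartial_append, sumPartial, List.length_cons]
        push_cast
        nlinarith
      rw [← hN, ← hlen]
      omega

/-! ### Integral combinations -/

/-- The ring `ℤ[t]` inside `ℚ(t)`. -/
def A : Subalgebra ℤ K := (Polynomial.aeval t : Polynomial ℤ →ₐ[ℤ] K).range

theorem t_mem : t ∈ A := ⟨Polynomial.X, by simp⟩

theorem smul_mem_of_mem {N : Submodule A Λ} {c : K} (hc : c ∈ A) {f : Λ} (hf : f ∈ N) : c • f ∈ N :=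
  N.smul_mem ⟨c, hc⟩ hf

/-- The product `h_{a₁} h_{a₂} ⋯`. -/
def hprod (a : List ℤ) : Λ := (a.map hZ).prod

theorem straighten_hprod (k : ℕ) (a : List ℤ) (ha : ∀ c ∈ a, c ≤ k) :
    hprod a ∈ Submodule.span A
      ((fun l => hprod (toInts l)) '' {l | IsBounded k l ∧ Dom a (toInts l)}) := by
  refine straighten (R := A) hprod (fun u a ha => ?_) (fun u => ?_) (fun u i j v hij => ?_) k a ha
  · simp [hprod, hZ_of_neg ha]
  · simp [hprod, hZ_zero]
  · refine Submodule.subset_span ⟨u ++ j :: i :: v, ⟨j, i, add_comm _ _, hij, le_rfl, rfl⟩, ?_⟩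
    simp only [hprod, List.map_append, List.map_cons, List.prod_append, List.prod_cons]
    ring

/-- The composite `B_{a₁} B_{a₂} ⋯` as a linear map. -/
def BseqLin : List ℤ → Λ →ₗ[K] Λ
  | [] => LinearMap.id
  | a :: l => BLin a ∘ₗ BseqLin l

theorem BseqLin_apply (a : List ℤ) (f : Λ) : BseqLin a f = Bseq a f := by
  induction a with
  | nil => rfl
  | cons a l ih => rw [BseqLin, LinearMap.comp_apply, BLin_apply, ih, Bseq, Bseq, List.foldr_cons]

theorem Bseq_append (u w : List ℤ) (f : Λ) : Bseq (u ++ w) f = Bseq u (Bseq w f) :=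
  List.foldr_append

/-- `H_a = B_{a₁} B_{a₂} ⋯ 1` for an integer sequence. -/
def HInt (a : List ℤ) : Λ := Bseq a 1

theorem HInt_append (u w : List ℤ) : HInt (u ++ w) = BseqLin u (HInt w) := by
  rw [BseqLin_apply]
  exact Bseq_append u w 1

theorem HInt_cons (a : ℤ) (l : List ℤ) : HInt (a :: l) = BLin a (HInt l) :=
  (BLin_apply _ _).symm

theorem HInt_toInts (l : List ℕ) : HInt (toInts l) = hallLittlewood l := by
  rw [hallLittlewood, HInt, toInts]
  congr 1
  simp only [List.bind_eq_flatMap, List.pure_def, List.map_id_fun', id_eq]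
  exact List.map_eq_flatMap

theorem straighten_HInt (k : ℕ) (a : List ℤ) (ha : ∀ c ∈ a, c ≤ k) :
    HInt a ∈ Submodule.span A
      ((fun l => HInt (toInts l)) '' {l | IsBounded k l ∧ Dom a (toInts l)}) := by
  have hone : ∀ c, HInt [c] = hZ c := fun c => B_one c
  refine straighten (R := A) HInt (fun u a ha => ?_) (fun u => ?_) (fun u i j v hij => ?_) k a ha
  · rw [HInt_append, hone, hZ_of_neg ha, map_zero]
  · rw [HInt_append, hone, hZ_zero, BseqLin_apply]
    rfl
  · have hrel : HInt (u ++ i :: j :: v) = t • HInt (u ++ (i + 1) :: (j - 1) :: v) +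
        t • HInt (u ++ j :: i :: v) - HInt (u ++ (j - 1) :: (i + 1) :: v) := by
      rw [HInt_append, HInt_append, HInt_append, HInt_append, ← map_smul, ← map_smul, ← map_add,
        ← map_sub]
      congr 1
      simp only [HInt_cons, BLin_apply]
      exact B_relation i j _
    have hmem : ∀ x y, x + y = i + j → i < x → x ≤ j → HInt (u ++ x :: y :: v) ∈ Submodule.span A
        (HInt '' {b | ∃ x y, x + y = i + j ∧ i < x ∧ x ≤ j ∧ b = u ++ x :: y :: v}) :=
      fun x y h1 h2 h3 => Submodule.subset_span ⟨_, ⟨x, y, h1, h2, h3, rfl⟩, rfl⟩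
    -- For adjacent values the last term of the relation is the left side itself. The relation then
    -- says `2F = 2tF'`, and cancelling 2 leaves the coefficient `t` in `ℤ[t]`.
    by_cases hj : j = i + 1
    · subst hj
      rw [add_sub_cancel_right] at hrel
      have : HInt (u ++ i :: (i + 1) :: v) = t • HInt (u ++ (i + 1) :: i :: v) := by
        refine smul_right_injective Λ (two_ne_zero (α := K)) ?_
        simp only [two_smul]
        nth_rewrite 1 [hrel]
        abel
      rw [this]
      exact smul_mem_of_mem t_mem (hmem _ _ (by ring) (by omega) le_rfl)
    · rw [hrel]
      exact sub_mem (add_mem (smul_mem_of_mem t_mem (hmem _ _ (by ring) (by omega) (by omega)))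
        (smul_mem_of_mem t_mem (hmem _ _ (by ring) hij le_rfl)))
        (hmem _ _ (by ring) (by omega) (by omega))

/-! ### Dominance of partitions -/

theorem eq_of_sum_take_eq {l m : List ℕ} (hl : ∀ a ∈ l, 0 < a) (hm : ∀ a ∈ m, 0 < a)
    (hlm : ∀ i, (l.take i).sum = (m.take i).sum) : l = m := by
  induction l generalizing m with
  | nil =>
    cases m with
    | nil => rfl
    | cons b m => have := hlm 1; have := hm b (by simp); simp at *; omega
  | cons a l ih =>
    cases m with
    | nil => have := hlm 1; have := hl a (by simp); simp at *; omega
    | cons b m =>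
      have hab : a = b := by simpa using hlm 1
      subst hab
      rw [ih (m := m) (fun c hc => hl c (by simp [hc])) (fun c hc => hm c (by simp [hc]))
        fun i => by simpa using hlm (i + 1)]

theorem sum_take_toInts (l : List ℕ) (i : ℕ) :
    ((toInts l).take i).sum = ((l.take i).sum : ℤ) := by
  rw [toInts, ← List.map_take, Nat.cast_list_sum]

theorem sum_toInts (l : List ℕ) : (toInts l).sum = (l.sum : ℤ) := (Nat.cast_list_sum _).symm

theorem dom_toInts {l m : List ℕ} :
    Dom (toInts l) (toInts m) ↔ l.sum = m.sum ∧ ∀ i, (l.take i).sum ≤ (m.take i).sum := by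
  simp only [Dom, sum_take_toInts, sum_toInts, Nat.cast_inj, Nat.cast_le]

theorem sDom_toInts {l m : List ℕ} (hl : IsPartition l) (hm : IsPartition m) :
    SDom (toInts l) (toInts m) ↔ StrictDom l m := by
  simp only [SDom, dom_toInts, StrictDom, and_assoc]
  refine and_congr_right fun h1 => and_congr_right fun h2 => not_congr ⟨?_, ?_⟩
  · rintro ⟨_, h3⟩
    exact eq_of_sum_take_eq hl.2 hm.2 fun i => le_antisymm (h2 i) (h3 i)
  · rintro rfl
    exact ⟨rfl, h2⟩

/-! ### Unitriangular families -/

section Unitriangular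

variable {R M ι : Type*} [Ring R] [AddCommGroup M] [Module R M]

/-- `f` is unitriangular in `g`: each `f i - g i` is a combination of the `g j` with `r i j`. -/
def Unitri (R : Type*) {M ι : Type*} [Ring R] [AddCommGroup M] [Module R M]
    (r : ι → ι → Prop) (f g : ι → M) : Prop :=
  ∀ i, f i - g i ∈ Submodule.span R (g '' {j | r i j})

variable {r : ι → ι → Prop} {f g u : ι → M}

theorem Unitri.mem (htr : ∀ i j l, r i j → r j l → r i l) (hfg : Unitri R r f g) {i : ι} {x : M}
    (hx : x ∈ Submodule.span R (f '' {j | r i j})) : x ∈ Submodule.span R (g '' {j | r i j}) := by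
  refine span_image_le (fun j hj => ?_) hx
  rw [← sub_add_cancel (f j) (g j)]
  refine add_mem ?_ (Submodule.subset_span ⟨j, hj, rfl⟩)
  exact Submodule.span_mono (Set.image_mono fun l hl => htr i j l hj hl) (hfg j)

theorem Unitri.trans (htr : ∀ i j l, r i j → r j l → r i l) (hfg : Unitri R r f g)
    (hgu : Unitri R r g u) : Unitri R r f u := by
  intro i
  rw [← sub_add_sub_cancel (f i) (g i) (u i)]
  exact add_mem (hgu.mem htr (hfg i)) (hgu i)

/-- Inversion by back substitution: the error terms have smaller `d`, so the induction rewrites them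
in the other family. -/
theorem Unitri.symm (htr : ∀ i j l, r i j → r j l → r i l) {d : ι → ℕ}
    (hd : ∀ i j, r i j → d j < d i) (hfg : Unitri R r f g) : Unitri R r g f := by
  intro i
  induction hn : d i using Nat.strong_induction_on generalizing i with
  | _ n ih =>
  rw [← neg_sub]
  refine neg_mem (span_image_le (fun j hj => ?_) (hfg i))
  rw [← sub_add_cancel (g j) (f j)]
  refine add_mem ?_ (Submodule.subset_span ⟨j, hj, rfl⟩)
  exact Submodule.span_mono (Set.image_mono fun l hl => htr i j l hj hl)
    (ih (d j) (hn ▸ hd i j hj) j rfl)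

end Unitriangular

theorem exists_linearMap_of_linearIndependent {F V W ι : Type*} [Field F] [AddCommGroup V]
    [Module F V] [AddCommGroup W] [Module F W] {g : ι → V} (hg : LinearIndependent F g)
    (w : ι → W) : ∃ T : V →ₗ[F] W, ∀ i, T (g i) = w i := by
  obtain ⟨T, hT⟩ := LinearMap.exists_extend ((Module.Basis.span hg).constr F w)
  refine ⟨T, fun i => ?_⟩
  have h1 := (Module.Basis.span hg).constr_basis F w i
  rw [← hT, LinearMap.comp_apply, Submodule.subtype_apply, Module.Basis.span_apply] at h1
  exact h1

theorem Unitri.linearIndependent {F V ι : Type*} [Field F] [AddCommGroup V] [Module F V]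
    {r : ι → ι → Prop} {f g : ι → V} {d : ι → ℕ} (hd : ∀ i j, r i j → d j < d i)
    (hfg : Unitri F r f g) (hg : LinearIndependent F g) : LinearIndependent F f := by
  classical
  rw [linearIndependent_iff']
  intro s c hc
  by_contra! hcon
  obtain ⟨i₀, hi₀, hci₀⟩ := hcon
  -- With `d i` maximal among indices of nonzero coefficient, no such `f j` involves `g i` in its
  -- error term. The coordinate functional at `g i` then reads off `c i`.
  obtain ⟨i, hi, hmax⟩ := Finset.exists_max_image (s.filter fun j => c j ≠ 0) d
    ⟨i₀, by simp [hi₀, hci₀]⟩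
  obtain ⟨e, he⟩ := exists_linearMap_of_linearIndependent hg (fun j => if j = i then (1 : F) else 0)
  have hspan : ∀ j, ¬ r j i → e (f j) = e (g j) := by
    intro j hj
    rw [← sub_eq_zero, ← map_sub]
    refine span_image_le (N := LinearMap.ker e) (fun l hl => ?_) (hfg j)
    rw [LinearMap.mem_ker, he, if_neg]
    rintro rfl
    exact hj hl
  have h1 := congrArg e hc
  rw [map_sum, map_zero, sum_eq_single i] at h1
  · rw [map_smul, hspan i fun hr => lt_irrefl _ (hd i i hr), he, if_pos rfl, smul_eq_mul,
      mul_one] at h1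
    exact (mem_filter.1 hi).2 h1
  · intro j hj hji
    by_cases hcj : c j = 0
    · rw [hcj, zero_smul, map_zero]
    · rw [map_smul, hspan j, he, if_neg hji, smul_zero]
      intro hr
      exact absurd (hmax j (by simp [hj, hcj])) (not_le.2 (hd j i hr))
  · intro hi'
    exact absurd (mem_filter.1 hi).1 hi'

theorem unitri_of_subring {r : ι → ι → Prop} {f g : ι → Λ} (hfg : Unitri A r f g) :
    Unitri K r f g := fun i => Submodule.span_subset_span A K _ (hfg i)

/-! ### The dominance order on sets of partitions -/

/-- Strict dominance on a family of partitions. -/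
def PDom {P : List ℕ → Prop} (l m : {l // P l}) : Prop := SDom (toInts l.1) (toInts m.1)

theorem PDom.trans {P : List ℕ → Prop} (l m n : {l // P l}) (h₁ : PDom l m) (h₂ : PDom m n) :
    PDom l n :=
  SDom.trans_dom h₁ h₂.1

/-- A function which strictly decreases along dominance. -/
def corank (l : List ℕ) : ℕ := ∑ i ∈ range (l.sum + 1), (l.sum - (l.take i).sum)

theorem length_le_sum_of_pos {l : List ℕ} (hl : ∀ a ∈ l, 0 < a) : l.length ≤ l.sum := by
  induction l with
  | nil => simp
  | cons a l ih =>
    have := ih fun b hb => hl b (by simp [hb])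
    have := hl a (by simp)
    simp only [List.length_cons, List.sum_cons]
    omega

/-- Positive parts bound the length by the sum, so the partial sums in the range determine the
partition and one of them must differ. -/
theorem corank_lt {l m : List ℕ} (hl : IsPartition l) (hm : IsPartition m)
    (hlm : SDom (toInts l) (toInts m)) : corank m < corank l := by
  obtain ⟨h1, h2, h3⟩ := (sDom_toInts hl hm).1 hlm
  unfold corank
  rw [← h1]
  have hle : ∀ i, (m.take i).sum ≤ l.sum := fun i => by
    rw [h1, ← List.sum_take_add_sum_drop m i]; omega
  refine sum_lt_sum (fun i _ => by have := h2 i; omega) ?_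
  by_contra! hcon
  refine h3 (eq_of_sum_take_eq hl.2 hm.2 fun i => ?_)
  by_cases hi : i ∈ range (l.sum + 1)
  · have := hcon i hi
    have := h2 i
    have := hle i
    omega
  · have hi' : l.sum < i := by simpa using hi
    have h4 := length_le_sum_of_pos hl.2
    have h5 := length_le_sum_of_pos hm.2
    rw [List.take_of_length_le (by omega), List.take_of_length_le (by omega), h1]

theorem corank_lt_of_pDom {P : List ℕ → Prop} (hP : ∀ l, P l → IsPartition l) (l m : {l // P l})
    (hlm : PDom l m) : corank m.1 < corank l.1 :=
  corank_lt (hP _ l.2) (hP _ m.2) hlm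

/-! ### Expansions in products of complete symmetric functions -/

theorem map_mem_of_span_image {ι : Type*} {F : ι → Λ} {S : Set ι} {N : Submodule A Λ}
    (φ : Λ →ₗ[K] Λ) (hS : ∀ i ∈ S, φ (F i) ∈ N) {x : Λ} (hx : x ∈ Submodule.span A (F '' S)) :
    φ x ∈ N :=
  span_image_le (N := N.comap (φ.restrictScalars A)) hS hx

theorem hsub_mem (n : ℕ) : hsub n ∈ A := by
  cases n with
  | zero => exact one_mem _
  | succ n => exact sub_mem (pow_mem t_mem _) (pow_mem t_mem _)

theorem hprod_cons (a : ℤ) (b : List ℤ) : hprod (a :: b) = hZ a * hprod b := by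
  simp [hprod]

/-- The sequences obtained from `a :: b` by lowering entries of `b` and raising `a` by the same
total amount. -/
def raised (a : ℤ) (b : List ℤ) : Set (List ℤ) :=
  {c | ∃ a' b', c = a' :: b' ∧ List.Forall₂ (· ≤ ·) b' b ∧ a' + b'.sum = a + b.sum ∧ a < a'}

theorem sDom_of_mem_raised {a : ℤ} {b c : List ℤ} (hc : c ∈ raised a b) : SDom (a :: b) c := by
  obtain ⟨a', b', rfl, h1, h2, h3⟩ := hc
  refine ⟨⟨by simp only [List.sum_cons]; omega, fun i => ?_⟩, fun hd => ?_⟩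
  · cases i with
    | zero => simp
    | succ i =>
      simp only [List.take_succ_cons, List.sum_cons]
      have h4 := (List.forall₂_drop i h1).sum_le_sum
      have h5 := List.sum_take_add_sum_drop b i
      have h6 := List.sum_take_add_sum_drop b' i
      omega
  · have := hd.2 1
    simp at this
    omega

/-- `B_a` is moved past the factors one at a time by `B_hZ_mul`; passing `h_n` replaces `n` by `n -
p` and `a` by `a + p`. The choice `p = 0` throughout gives the leading term. -/
theorem BLin_hprod_raised (b : List ℤ) (a : ℤ) :
    BLin a (hprod b) - hprod (a :: b) ∈ Submodule.span A (hprod '' raised a b) := by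
  induction b generalizing a with
  | nil =>
    have : BLin a (hprod []) - hprod [a] = 0 := by
      simp [hprod, BLin_apply, B_one]
    rw [this]
    exact zero_mem _
  | cons n b ih =>
    have hmul : ∀ q : ℕ, hZ (n - q) * (BLin (a + q) (hprod b) - hprod ((a + q) :: b)) ∈
        Submodule.span A (hprod '' raised a (n :: b)) := by
      intro q
      refine map_mem_of_span_image (LinearMap.mulLeft K (hZ (n - q))) ?_ (ih (a + q))
      rintro c ⟨a', b', rfl, h1, h2, h3⟩
      refine Submodule.subset_span ⟨a' :: (n - q) :: b', ⟨a', (n - q) :: b', rfl,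
        List.Forall₂.cons (by omega) h1, by simp only [List.sum_cons]; omega, by omega⟩, ?_⟩
      simp only [hprod_cons, LinearMap.mulLeft_apply]
      ring
    have hmul' : ∀ q : ℕ, 0 < q → hZ (n - q) * BLin (a + q) (hprod b) ∈
        Submodule.span A (hprod '' raised a (n :: b)) := by
      intro q hq
      rw [← sub_add_cancel (BLin (a + q) (hprod b)) (hprod ((a + q) :: b)), mul_add]
      refine add_mem (hmul q) (Submodule.subset_span ⟨(a + q) :: (n - q) :: b,
        ⟨a + q, (n - q) :: b, rfl, List.Forall₂.cons (by omega) (List.forall₂_refl b),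
          by simp only [List.sum_cons]; omega, by omega⟩, ?_⟩)
      simp only [hprod_cons]
      ring
    have hexp : BLin a (hprod (n :: b)) - hprod (a :: n :: b) =
        ∑ q ∈ range n.toNat, hsub (q + 1) •
          (hZ (n - (q + 1 : ℕ)) * BLin (a + (q + 1 : ℕ)) (hprod b)) +
        hZ (n - (0 : ℕ)) * (BLin (a + (0 : ℕ)) (hprod b) - hprod ((a + (0 : ℕ)) :: b)) := by
      rw [hprod_cons, BLin_apply, B_hZ_mul a n (n.toNat + 1) (by omega), sum_range_succ',
        hsub_zero, one_smul, mul_sub]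
      simp only [hprod_cons, BLin_apply, Nat.cast_zero, sub_zero, add_zero]
      ring
    rw [hexp]
    exact add_mem (sum_mem fun q _ => smul_mem_of_mem (hsub_mem _) (hmul' _ q.succ_pos)) (hmul 0)

theorem HInt_sub_hprod (a : List ℤ) :
    HInt a - hprod a ∈ Submodule.span A (hprod '' {c | SDom a c}) := by
  induction a with
  | nil =>
    have : HInt [] - hprod [] = 0 := by simp [HInt, Bseq, hprod]
    rw [this]
    exact zero_mem _
  | cons a b ih =>
    have hB : ∀ b, BLin a (hprod b) - hprod (a :: b) ∈
        Submodule.span A (hprod '' {c | SDom (a :: b) c}) := fun b =>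
      Submodule.span_mono (Set.image_mono fun c hc => sDom_of_mem_raised hc)
        (BLin_hprod_raised b a)
    rw [HInt_cons, ← sub_add_sub_cancel _ (BLin a (hprod b)), ← map_sub]
    refine add_mem (map_mem_of_span_image (BLin a) (fun c hc => ?_) ih) (hB b)
    rw [← sub_add_cancel (BLin a (hprod c)) (hprod (a :: c))]
    refine add_mem (Submodule.span_mono (Set.image_mono fun e he => ?_) (hB c))
      (Submodule.subset_span ⟨a :: c, SDom.cons a hc, rfl⟩)
    exact (SDom.cons a hc).trans_dom he.1

/-! ### Jacobi–Trudi expansion and dominance -/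

theorem sum_take_ofFn' {n : ℕ} (f : Fin n → ℤ) (i : ℕ) :
    ((List.ofFn f).take i).sum = ∑ j with j.val < i, f j :=
  List.sum_take_ofFn f i

/-- Truncating values at `i` leaves the total invariant under `σ`. Outside the first `i` positions
the identity already attains the cap `i`, so inside them it has the smaller sum. -/
theorem sum_le_sum_perm {n : ℕ} (σ : Equiv.Perm (Fin n)) (i : ℕ) :
    ∑ j : Fin n with j.val < i, ((j : ℕ) : ℤ) ≤ ∑ j : Fin n with j.val < i, ((σ j : ℕ) : ℤ) := by
  have h1 : ∑ j, min ((σ j : ℕ) : ℤ) i = ∑ j : Fin n, min ((j : ℕ) : ℤ) i :=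
    Equiv.sum_comp σ fun j : Fin n => min ((j : ℕ) : ℤ) i
  rw [← sum_filter_add_sum_filter_not univ (fun j : Fin n => (j : ℕ) < i),
    ← sum_filter_add_sum_filter_not univ (fun j : Fin n => (j : ℕ) < i)
      (fun j : Fin n => min ((j : ℕ) : ℤ) i)] at h1
  have h2 : ∑ j : Fin n with j.val < i, min ((σ j : ℕ) : ℤ) i ≤
      ∑ j : Fin n with j.val < i, ((σ j : ℕ) : ℤ) := sum_le_sum fun j _ => min_le_left _ _
  have h3 : ∑ j : Fin n with ¬ j.val < i, min ((σ j : ℕ) : ℤ) i ≤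
      ∑ j : Fin n with ¬ j.val < i, min ((j : ℕ) : ℤ) i := by
    refine sum_le_sum fun j hj => ?_
    have := (mem_filter.1 hj).2
    omega
  have h4 : ∑ j : Fin n with j.val < i, min ((j : ℕ) : ℤ) i =
      ∑ j : Fin n with j.val < i, ((j : ℕ) : ℤ) := by
    refine sum_congr rfl fun j hj => ?_
    have := (mem_filter.1 hj).2
    omega
  omega

theorem eq_of_dom_of_dom {n : ℕ} {f g : Fin n → ℤ} (h₁ : Dom (List.ofFn f) (List.ofFn g))
    (h₂ : Dom (List.ofFn g) (List.ofFn f)) : f = g := by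
  have key : ∀ {l m : List ℤ}, l.length = m.length → (∀ i, (l.take i).sum = (m.take i).sum) →
      l = m := by
    intro l
    induction l with
    | nil => intro m hlen _; exact (List.eq_nil_of_length_eq_zero hlen.symm).symm
    | cons a l ih =>
      intro m hlen hs
      cases m with
      | nil => simp at hlen
      | cons b m =>
        have hab : a = b := by simpa using hs 1
        subst hab
        rw [ih (m := m) (by simpa using hlen) fun i => by simpa using hs (i + 1)]
  exact List.ofFn_injective (key (by simp) fun i => le_antisymm (h₁.2 i) (h₂.2 i))

theorem ofFn_get_eq_toInts (l : List ℕ) :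
    List.ofFn (fun i : Fin l.length => ((l.get i : ℕ) : ℤ)) = toInts l := by
  unfold toInts
  conv_rhs => rw [← List.ofFn_get l, List.map_ofFn]
  rfl

/-- The term of `σ` has indices `λ_i - i + σ(i)`. Its partial sums are at least those of `λ` by
`sum_le_sum_perm`, with equality throughout only for `σ = 1`. -/
theorem schur_sub_hprod (l : List ℕ) :
    schur l - hprod (toInts l) ∈ Submodule.span A (hprod '' {c | SDom (toInts l) c}) := by
  have hdet : schur l = ∑ σ : Equiv.Perm (Fin l.length), Equiv.Perm.sign σ •
      hprod (List.ofFn fun i => (l.get i : ℤ) - (i : ℕ) + (σ i : ℕ)) := by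
    rw [schur, ← Matrix.det_transpose, Matrix.det_apply]
    refine sum_congr rfl fun σ _ => ?_
    rw [hprod, List.map_ofFn, List.prod_ofFn]
    rfl
  have hone : hprod (toInts l) = Equiv.Perm.sign (1 : Equiv.Perm (Fin l.length)) •
      hprod (List.ofFn fun i => (l.get i : ℤ) - (i : ℕ) +
        ((1 : Equiv.Perm (Fin l.length)) i : ℕ)) := by
    rw [Equiv.Perm.sign_one, one_smul, ← ofFn_get_eq_toInts]
    congr 2
    ext i
    simp
  rw [hdet, hone, ← add_sum_erase _ _ (mem_univ (1 : Equiv.Perm (Fin l.length))),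
    add_sub_cancel_left]
  refine sum_mem fun σ hσ => ?_
  have hσ1 : σ ≠ 1 := (mem_erase.1 hσ).1
  have hdom : Dom (toInts l) (List.ofFn fun i => (l.get i : ℤ) - (i : ℕ) + (σ i : ℕ)) := by
    rw [← ofFn_get_eq_toInts]
    refine ⟨?_, fun i => ?_⟩
    · rw [List.sum_ofFn, List.sum_ofFn, sum_add_distrib, sum_sub_distrib,
        Equiv.sum_comp σ fun j : Fin l.length => ((j : ℕ) : ℤ)]
      ring
    · rw [sum_take_ofFn', sum_take_ofFn', sum_add_distrib, sum_sub_distrib]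
      have := sum_le_sum_perm σ i
      linarith
  have hmem : hprod (List.ofFn fun i => (l.get i : ℤ) - (i : ℕ) + (σ i : ℕ)) ∈
      Submodule.span A (hprod '' {c | SDom (toInts l) c}) := by
    refine Submodule.subset_span ⟨_, ⟨hdom, fun hd => hσ1 ?_⟩, rfl⟩
    rw [← ofFn_get_eq_toInts] at hdom hd
    have h1 := eq_of_dom_of_dom hdom hd
    ext i
    have h2 := congrFun h1 i
    simp only [Equiv.Perm.coe_one, id_eq]
    omega
  rcases Int.units_eq_one_or (Equiv.Perm.sign σ) with hs | hs
  · rw [hs, one_smul]; exact hmem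
  · rw [hs, Units.neg_smul, one_smul]; exact neg_mem hmem

theorem exists_bound (a : List ℤ) : ∃ k : ℕ, ∀ c ∈ a, c ≤ k := by
  induction a with
  | nil => exact ⟨0, by simp⟩
  | cons b a ih =>
    obtain ⟨k, hk⟩ := ih
    refine ⟨k + b.toNat, fun c hc => ?_⟩
    rcases List.mem_cons.1 hc with rfl | hc
    · omega
    · have := hk c hc; omega

/-- The type of all partitions. -/
abbrev Ptn : Type := {l : List ℕ // IsPartition l}

theorem hprod_span_le_partitions (l : Ptn) :
    Submodule.span A (hprod '' {c | SDom (toInts l.1) c}) ≤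
      Submodule.span A ((fun m : Ptn => hprod (toInts m.1)) '' {m | PDom l m}) := by
  intro x hx
  refine span_image_le (fun c hc => ?_) hx
  obtain ⟨k, hk⟩ := exists_bound c
  refine span_image_le (fun m hm => ?_) (straighten_hprod k c hk)
  exact Submodule.subset_span ⟨⟨m, hm.1.1⟩, SDom.trans_dom hc hm.2, rfl⟩

theorem unitri_HInt_hprod : Unitri A PDom (fun m : Ptn => HInt (toInts m.1))
    (fun m : Ptn => hprod (toInts m.1)) :=
  fun l => hprod_span_le_partitions l (HInt_sub_hprod _)

theorem unitri_schur_hprod : Unitri A PDom (fun m : Ptn => schur m.1)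
    (fun m : Ptn => hprod (toInts m.1)) :=
  fun l => hprod_span_le_partitions l (schur_sub_hprod _)

theorem unitri_HInt_schur : Unitri A PDom (fun m : Ptn => HInt (toInts m.1))
    (fun m : Ptn => schur m.1) :=
  unitri_HInt_hprod.trans PDom.trans
    (unitri_schur_hprod.symm PDom.trans (corank_lt_of_pDom fun _ h => h))

/-! ### Linear independence -/

/-- The power sum `p_{n+1}` as a polynomial in the variables `X i = h_{i+1}`. -/
def psumInH : ℕ → Λ
  | n => ((n : K) + 1) • MvPolynomial.X n -
      ∑ i : Fin n, psumInH i * MvPolynomial.X (n - 1 - i)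

theorem aeval_psumInH_h (n : ℕ) :
    MvPolynomial.aeval psumInH (h (n + 1)) = (MvPolynomial.X n : Λ) := by
  induction n using Nat.strong_induction_on with
  | _ n ih =>
  have hn : ((n : K) + 1) ≠ 0 := by exact_mod_cast Nat.succ_ne_zero n
  refine smul_right_injective Λ hn ?_
  simp only
  rw [← map_smul, newton_h, map_sum, sum_range_succ, Nat.sub_self]
  have h1 : ∀ i ∈ range n, MvPolynomial.aeval psumInH (MvPolynomial.X i * h (n - i)) =
      psumInH i * (MvPolynomial.X (n - 1 - i) : Λ) := by
    intro i hi
    have hi' := mem_range.1 hi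
    have : n - i = n - 1 - i + 1 := by omega
    rw [map_mul, MvPolynomial.aeval_X, this, ih (n - 1 - i) (by omega)]
  rw [sum_congr rfl h1, map_mul, MvPolynomial.aeval_X, h, map_one, mul_one]
  conv_lhs => rw [psumInH]
  rw [Fin.sum_univ_eq_sum_range (fun i => psumInH i * (MvPolynomial.X (n - 1 - i) : Λ))]
  abel

/-- The homomorphism given by `psumInH` sends `h_{n+1}` to the variable `X n`, so the products
become distinct monomials. -/
theorem linearIndependent_hprod :
    LinearIndependent K (fun m : Ptn => hprod (toInts m.1)) := by
  refine LinearIndependent.of_comp (MvPolynomial.aeval psumInH : Λ →ₐ[K] Λ).toLinearMap ?_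
  let e : Ptn → ℕ →₀ ℕ := fun m => Multiset.toFinsupp ((m.1.map (· - 1) : List ℕ) : Multiset ℕ)
  have he : ∀ m : Ptn, (MvPolynomial.aeval psumInH : Λ →ₐ[K] Λ) (hprod (toInts m.1)) =
      MvPolynomial.monomial (e m) 1 := by
    rintro ⟨l, hl₀, hl⟩
    simp only [e]
    clear hl₀
    induction l with
    | nil => simp [toInts, hprod]
    | cons a l ih =>
      have ha := hl a (by simp)
      obtain ⟨b, rfl⟩ : ∃ b, a = b + 1 := ⟨a - 1, by omega⟩
      have ih' := ih fun c hc => hl c (by simp [hc])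
      have h1 : toInts ((b + 1) :: l) = ((b + 1 : ℕ) : ℤ) :: toInts l := by simp [toInts]
      rw [h1, hprod_cons, map_mul, ih', hZ_natCast, aeval_psumInH_h, MvPolynomial.X,
        MvPolynomial.monomial_mul, one_mul, List.map_cons, ← Multiset.cons_coe,
        ← Multiset.singleton_add, map_add, Multiset.toFinsupp_singleton, Nat.add_sub_cancel]
  have hinj : Function.Injective e := by
    rintro ⟨l, hl, hl'⟩ ⟨m, hm, hm'⟩ hlm
    have h1 := Multiset.toFinsupp.injective hlm
    rw [Multiset.coe_eq_coe] at h1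
    have h2 := h1.map (· + 1)
    have h3 : ∀ {l : List ℕ}, (∀ a ∈ l, 0 < a) → (l.map (· - 1)).map (· + 1) = l := by
      intro l hl
      rw [List.map_map]
      conv_rhs => rw [← List.map_id l]
      refine List.map_congr_left fun a ha => ?_
      exact Nat.sub_add_cancel (hl a ha)
    simp only at h2
    rw [h3 hl', h3 hm'] at h2
    exact Subtype.ext (h2.eq_of_pairwise (fun a b _ _ h4 h5 => le_antisymm h5 h4) hl hm)
  have h4 : (⇑(MvPolynomial.aeval psumInH : Λ →ₐ[K] Λ).toLinearMap ∘
      fun m : Ptn => hprod (toInts m.1)) = ⇑(MvPolynomial.basisMonomials ℕ K) ∘ e := by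
    ext1 m
    exact (he m).trans (by simp)
  rw [h4]
  exact (MvPolynomial.basisMonomials ℕ K).linearIndependent.comp e hinj

theorem linearIndependent_HInt :
    LinearIndependent K (fun m : Ptn => HInt (toInts m.1)) :=
  (unitri_of_subring unitri_HInt_hprod).linearIndependent (corank_lt_of_pDom fun _ h => h)
    linearIndependent_hprod

/-! ### `k`-split polynomials -/

/-- The index sequence of the summand of `B_q` that belongs to the set `E` of pairs. -/
def raiseBy (q : List ℕ) (E : Finset (Fin q.length × Fin q.length)) : List ℤ :=
  List.ofFn fun r : Fin q.length => (q.get r : ℤ) + ((E.filter fun e => e.1 = r).card : ℤ)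
    - ((E.filter fun e => e.2 = r).card : ℤ)

/-- `B_q` as a linear map. -/
def BpartLin (q : List ℕ) : Λ →ₗ[K] Λ :=
  ∑ E ∈ ((Finset.univ : Finset (Fin q.length × Fin q.length)).filter
      fun e => e.1 < e.2).powerset, ((-t) ^ E.card) • BseqLin (raiseBy q E)

theorem BpartLin_apply (q : List ℕ) (f : Λ) : BpartLin q f = Bpart q f := by
  simp only [BpartLin, LinearMap.sum_apply, LinearMap.smul_apply, BseqLin_apply]
  rfl

theorem length_raiseBy (q : List ℕ) (E : Finset (Fin q.length × Fin q.length)) :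
    (raiseBy q E).length = q.length := by
  simp [raiseBy]

theorem length_toInts (l : List ℕ) : (toInts l).length = l.length := by
  simp [toInts]

theorem sum_take_raiseBy (q : List ℕ) (E : Finset (Fin q.length × Fin q.length)) (i : ℕ) :
    ((raiseBy q E).take i).sum = ((toInts q).take i).sum +
      ((E.filter fun e => e.1.val < i).card : ℤ) - ((E.filter fun e => e.2.val < i).card : ℤ) := by
  rw [raiseBy, ← ofFn_get_eq_toInts, sum_take_ofFn', sum_take_ofFn', sum_sub_distrib,
    sum_add_distrib, ← Nat.cast_sum, ← Nat.cast_sum, ← Nat.cast_sum, sum_card_fiberwise_eq_card_filter,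
    sum_card_fiberwise_eq_card_filter]
  simp

theorem sum_raiseBy (q : List ℕ) (E : Finset (Fin q.length × Fin q.length)) :
    (raiseBy q E).sum = (toInts q).sum := by
  have h1 := sum_take_raiseBy q E q.length
  rw [List.take_of_length_le (length_raiseBy q E).le,
    List.take_of_length_le (length_toInts q).le] at h1
  simpa using h1

/-- Every pair whose lowered position is among the first `i` also has its raised position there, as
`e.1 < e.2`. A pair `e₀` gives a strict gain just after position `e₀.1`. -/
theorem sDom_raiseBy (q : List ℕ) (E : Finset (Fin q.length × Fin q.length))
    (hE : ∀ e ∈ E, e.1 < e.2) (hne : E.Nonempty) : SDom (toInts q) (raiseBy q E) := by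
  refine ⟨⟨(sum_raiseBy q E).symm, fun i => ?_⟩, fun hd => ?_⟩
  · rw [sum_take_raiseBy]
    have : (E.filter fun e => e.2.val < i) ⊆ E.filter fun e => e.1.val < i := by
      intro e he
      have h1 := mem_filter.1 he
      exact mem_filter.2 ⟨h1.1, lt_trans (hE e h1.1) h1.2⟩
    have := card_le_card this
    omega
  · obtain ⟨e₀, he₀⟩ := hne
    have h1 := hd.2 (e₀.1.val + 1)
    rw [sum_take_raiseBy] at h1
    have : (E.filter fun e => e.2.val < e₀.1.val + 1) ⊂
        E.filter fun e => e.1.val < e₀.1.val + 1 := by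
      refine (Finset.ssubset_iff_of_subset fun e he => ?_).2 ⟨e₀, ?_, ?_⟩
      · have h1 := mem_filter.1 he
        exact mem_filter.2 ⟨h1.1, lt_trans (hE e h1.1) h1.2⟩
      · simp [he₀]
      · have : e₀.1.val < e₀.2.val := hE e₀ he₀
        simp only [mem_filter, not_and]
        omega
    have := card_lt_card this
    omega

/-- A position is raised at most once for each other position, so its entry is at most `q₁ + ℓ(q) -
1`, the main hook-length. This is where the size of the pieces of the `k`-split matters. -/
theorem raiseBy_le {k : ℕ} {q : List ℕ} (hq : q.Pairwise (· ≥ ·)) (hk : mainHook q ≤ k)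
    (E : Finset (Fin q.length × Fin q.length)) (hE : ∀ e ∈ E, e.1 < e.2) :
    ∀ c ∈ raiseBy q E, c ≤ k := by
  intro c hc
  obtain ⟨r, rfl⟩ := (List.mem_ofFn' _ _).1 hc
  have h1 : q.get r ≤ q.headD 0 := by
    cases q with
    | nil => exact r.elim0
    | cons a l =>
      rcases List.mem_cons.1 (List.get_mem (a :: l) r) with h1 | h1
      · exact h1.le
      · exact (List.pairwise_cons.1 hq).1 _ h1
  have h2 : (E.filter fun e => e.1 = r).card ≤ q.length - 1 := by
    have h3 : (E.filter fun e => e.1 = r).card ≤ ((univ : Finset (Fin q.length)).erase r).card := by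
      refine card_le_card_of_injOn Prod.snd (fun e he => ?_) fun e he e' he' hee => ?_
      · have h4 := mem_filter.1 he
        simp only [coe_erase, coe_univ, Set.mem_sdiff, Set.mem_univ, Set.mem_singleton_iff,
          true_and]
        rintro h5
        have := hE e h4.1
        rw [h4.2, h5] at this
        exact lt_irrefl _ this
      · exact Prod.ext ((mem_filter.1 he).2.trans (mem_filter.1 he').2.symm) hee
    simpa using h3
  have h3 := r.2
  unfold mainHook at hk
  simp only
  omega

theorem raiseBy_empty (q : List ℕ) : raiseBy q ∅ = toInts q := by
  simp [raiseBy, ← ofFn_get_eq_toInts]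

/-- The sequences bounded by `k` that strictly dominate `a`. -/
def above (k : ℕ) (a : List ℤ) : Set (List ℤ) := {c | SDom a c ∧ ∀ x ∈ c, x ≤ k}

theorem Bpart_HInt {k : ℕ} {q : List ℕ} (hq : q.Pairwise (· ≥ ·)) (hk : mainHook q ≤ k)
    {c : List ℤ} (hc : ∀ x ∈ c, x ≤ k) :
    BpartLin q (HInt c) - HInt (toInts q ++ c) ∈
      Submodule.span A (HInt '' above k (toInts q ++ c)) := by
  simp only [BpartLin, LinearMap.sum_apply, LinearMap.smul_apply, ← HInt_append]
  rw [← add_sum_erase _ _ (empty_mem_powerset _), card_empty, pow_zero, one_smul, raiseBy_empty,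
    add_sub_cancel_left]
  refine sum_mem fun E hE => smul_mem_of_mem (pow_mem (neg_mem t_mem) _) ?_
  have hlt : ∀ e ∈ E, e.1 < e.2 := fun e he =>
    (mem_filter.1 (mem_powerset.1 (mem_erase.1 hE).2 he)).2
  have hs := sDom_raiseBy q E hlt (nonempty_iff_ne_empty.2 (mem_erase.1 hE).1)
  have hlen : (toInts q).length = (raiseBy q E).length := by rw [length_toInts, length_raiseBy]
  refine Submodule.subset_span ⟨_, ⟨⟨?_, fun hd => hs.2 ?_⟩, fun x hx => ?_⟩, rfl⟩
  · exact (dom_append_iff hlen hs.1.1).2 ⟨hs.1, Dom.refl c⟩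
  · exact ((dom_append_iff hlen.symm hs.1.1.symm).1 hd).1
  · rcases List.mem_append.1 hx with hx | hx
    · exact raiseBy_le hq hk E hlt x hx
    · exact hc x hx

theorem toInts_append (l m : List ℕ) : toInts (l ++ m) = toInts l ++ toInts m := List.map_append

theorem toInts_le {k : ℕ} {l : List ℕ} (hl : ∀ a ∈ l, a ≤ k) : ∀ x ∈ toInts l, x ≤ k := by
  intro x hx
  obtain ⟨a, ha, rfl⟩ := List.mem_map.1 hx
  exact_mod_cast hl a ha

/-- Pieces are prepended one by one: the empty set of pairs gives concatenation, all other terms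
move strictly up. The bound `k` is carried along so that the later straightening stays among
`k`-bounded partitions. -/
theorem genProd_sub_HInt {k : ℕ} (S : List (List ℕ))
    (hS : ∀ q ∈ S, q.Pairwise (· ≥ ·) ∧ mainHook q ≤ k ∧ ∀ a ∈ q, a ≤ k) :
    genProd S - HInt (toInts S.flatten) ∈
      Submodule.span A (HInt '' above k (toInts S.flatten)) := by
  induction S with
  | nil =>
    have : genProd [] - HInt (toInts [].flatten) = 0 := by simp [genProd, HInt, toInts, Bseq]
    rw [this]
    exact zero_mem _
  | cons q S ih =>
    have ih' := ih fun p hp => hS p (by simp [hp])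
    obtain ⟨h1, h2, h3⟩ := hS q (by simp)
    have hbd : ∀ x ∈ toInts S.flatten, x ≤ k := toInts_le fun a ha => by
      obtain ⟨p, hp, hap⟩ := List.mem_flatten.1 ha
      exact (hS p (by simp [hp])).2.2 a hap
    have hgen : genProd (q :: S) = BpartLin q (genProd S) := (BpartLin_apply _ _).symm
    rw [List.flatten_cons, toInts_append, hgen,
      ← sub_add_sub_cancel _ (BpartLin q (HInt (toInts S.flatten))), ← map_sub]
    refine add_mem (map_mem_of_span_image (BpartLin q) (fun c hc => ?_) ih')
      (Bpart_HInt h1 h2 hbd)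
    have hs : SDom (toInts q ++ toInts S.flatten) (toInts q ++ c) :=
      ⟨hc.1.1.append_left _, fun hd => hc.1.2 ((dom_append_iff rfl rfl).1 hd).2⟩
    rw [← sub_add_cancel (BpartLin q (HInt c)) (HInt (toInts q ++ c))]
    refine add_mem (Submodule.span_mono (Set.image_mono fun e he => ?_) (Bpart_HInt h1 h2 hc.2))
      (Submodule.subset_span ⟨_, ⟨hs, fun x hx => ?_⟩, rfl⟩)
    · exact ⟨hs.trans_dom he.1.1, he.2⟩
    · rcases List.mem_append.1 hx with hx | hx
      · exact toInts_le h3 x hx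
      · exact hc.2 x hx

/-- The type of `k`-bounded partitions. -/
abbrev BPtn (k : ℕ) : Type := {l : List ℕ // IsBounded k l}

/-- The integral span of the `H_m` over the `k`-bounded partitions `m` strictly dominating `l`. -/
theorem HInt_above_le (k : ℕ) (l : BPtn k) :
    Submodule.span A (HInt '' above k (toInts l.1)) ≤
      Submodule.span A ((fun m : BPtn k => HInt (toInts m.1)) '' {m | PDom l m}) := by
  intro x hx
  refine span_image_le (fun c hc => ?_) hx
  refine span_image_le (fun m hm => ?_) (straighten_HInt k c hc.2)
  exact Submodule.subset_span ⟨⟨m, hm.1⟩, hc.1.trans_dom hm.2, rfl⟩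

theorem unitri_kSplitPoly_HInt (k : ℕ) : Unitri A PDom (fun m : BPtn k => kSplitPoly k m.1)
    (fun m : BPtn k => HInt (toInts m.1)) := by
  intro l
  refine HInt_above_le k l ?_
  have h1 := genProd_sub_HInt (k := k) (ksplit k l.1) fun q hq => by
    have hsub : q.Sublist l.1 := by
      rw [← ksplit_flatten k l.1]
      exact List.sublist_flatten_of_mem hq
    exact ⟨l.2.1.1.sublist hsub, (ksplit_mainHook_le k l.1 l.2.2 q hq).2,
      fun a ha => l.2.2 a (hsub.subset ha)⟩
  rw [ksplit_flatten] at h1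
  exact h1

theorem unitri_HInt_kSplitPoly (k : ℕ) : Unitri A PDom
    (fun m : BPtn k => HInt (toInts m.1)) (fun m : BPtn k => kSplitPoly k m.1) :=
  (unitri_kSplitPoly_HInt k).symm PDom.trans (corank_lt_of_pDom fun _ h => h.1)

theorem linearIndependent_kSplitPoly (k : ℕ) :
    LinearIndependent K (fun m : BPtn k => kSplitPoly k m.1) := by
  refine (unitri_of_subring (unitri_kSplitPoly_HInt k)).linearIndependent
    (corank_lt_of_pDom fun _ h => h.1) ?_
  exact linearIndependent_HInt.comp (fun m : BPtn k => (⟨m.1, m.2.1⟩ : Ptn))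
    fun m n hmn => Subtype.ext (Subtype.mk.inj hmn)

/-! ### The projections -/

theorem HInt_mem_ΛB {k : ℕ} (l : BPtn k) : HInt (toInts l.1) ∈ ΛB k := by
  rw [HInt_toInts]
  exact Submodule.subset_span ⟨l.1, l.2, rfl⟩

theorem span_HInt_le_ΛB (k : ℕ) (S : Set (BPtn k)) {x : Λ}
    (hx : x ∈ Submodule.span A ((fun m : BPtn k => HInt (toInts m.1)) '' S)) : x ∈ ΛB k :=
  span_image_le (N := ΛB k) (fun m _ => HInt_mem_ΛB m)
    (Submodule.span_subset_span A K _ hx)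

theorem kSplitPoly_mem_ΛB {k : ℕ} (l : BPtn k) : kSplitPoly k l.1 ∈ ΛB k := by
  rw [← sub_add_cancel (kSplitPoly k l.1) (HInt (toInts l.1))]
  exact add_mem (span_HInt_le_ΛB k _ (unitri_kSplitPoly_HInt k l)) (HInt_mem_ΛB l)

/-- The choice operator has the defining property only if some operator does; linear independence of
the `k`-split polynomials allows their images to be prescribed. -/
theorem isProj_proj (k j : ℕ) : IsProj k j (proj k j) := by
  refine Classical.epsilon_spec (p := IsProj k j) ?_
  have hli : LinearIndependent K
      (fun m : BPtn k => (⟨kSplitPoly k m.1, kSplitPoly_mem_ΛB m⟩ : ΛB k)) :=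
    LinearIndependent.of_comp (ΛB k).subtype (linearIndependent_kSplitPoly k)
  obtain ⟨T, hT⟩ := exists_linearMap_of_linearIndependent hli fun m =>
    if m.1.headD 0 = j then (⟨kSplitPoly k m.1, kSplitPoly_mem_ΛB m⟩ : ΛB k) else 0
  exact ⟨T, fun l hl => ⟨kSplitPoly_mem_ΛB ⟨l, hl⟩, hT ⟨l, hl⟩⟩⟩

theorem proj_kSplitPoly {k : ℕ} (j : ℕ) (l : BPtn k) :
    (proj k j ⟨kSplitPoly k l.1, kSplitPoly_mem_ΛB l⟩ : Λ) =
      if l.1.headD 0 = j then kSplitPoly k l.1 else 0 := by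
  obtain ⟨_, h⟩ := isProj_proj k j l.1 l.2
  rw [h]
  split_ifs <;> rfl

/-- The projection is diagonal with entries 0 and 1 on the `k`-split polynomials, so it introduces
neither denominators nor new indices. -/
theorem proj_mem {k : ℕ} (j : ℕ) (S : Set (BPtn k)) (x : ΛB k)
    (hx : (x : Λ) ∈ Submodule.span A ((fun m : BPtn k => kSplitPoly k m.1) '' S)) :
    (proj k j x : Λ) ∈ Submodule.span A ((fun m : BPtn k => kSplitPoly k m.1) '' S) := by
  have hx' : x ∈ Submodule.span A
      ((fun m : BPtn k => (⟨kSplitPoly k m.1, kSplitPoly_mem_ΛB m⟩ : ΛB k)) '' S) := by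
    have himg : (fun m : BPtn k => kSplitPoly k m.1) '' S =
        ((ΛB k).subtype.restrictScalars A) ''
          ((fun m : BPtn k => (⟨kSplitPoly k m.1, kSplitPoly_mem_ΛB m⟩ : ΛB k)) '' S) := by
      rw [Set.image_image]
      rfl
    rw [himg, Submodule.span_image] at hx
    obtain ⟨y, hy, hyx⟩ := hx
    rwa [← Subtype.ext hyx]
  refine span_image_le (N := (Submodule.span A
    ((fun m : BPtn k => kSplitPoly k m.1) '' S)).comap
      (((ΛB k).subtype ∘ₗ proj k j).restrictScalars A)) (fun m hm => ?_) hx'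
  change (proj k j ⟨kSplitPoly k m.1, kSplitPoly_mem_ΛB m⟩ : Λ) ∈
    Submodule.span A ((fun m : BPtn k => kSplitPoly k m.1) '' S)
  rw [proj_kSplitPoly]
  split_ifs
  · exact Submodule.subset_span ⟨m, hm, rfl⟩
  · exact zero_mem _

/-! ### `k`-Schur functions -/

theorem kSchur_sub_HInt (k : ℕ) (l : List ℕ) (hl : IsBounded k l) :
    kSchur k l - HInt (toInts l) ∈ Submodule.span A
      ((fun m : BPtn k => HInt (toInts m.1)) '' {m | PDom ⟨l, hl⟩ m}) := by
  induction l with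
  | nil =>
    have : kSchur k [] - HInt (toInts []) = 0 := by simp [kSchur, HInt, toInts, Bseq]
    rw [this]
    exact zero_mem _
  | cons a l ih =>
    have hl' : IsBounded k l := ⟨⟨hl.1.1.of_cons, fun b hb => hl.1.2 b (by simp [hb])⟩,
      fun b hb => hl.2 b (by simp [hb])⟩
    have hcons : ∀ m, toInts (a :: m) = (a : ℤ) :: toInts m := fun m => rfl
    have ha : a ≤ k := hl.2 a (by simp)
    let p : BPtn k := ⟨a :: l, hl⟩
    have h1 : B a (kSchur k l) - HInt (toInts (a :: l)) ∈ Submodule.span A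
        ((fun m : BPtn k => HInt (toInts m.1)) '' {m | PDom p m}) := by
      rw [hcons, HInt_cons, ← BLin_apply, ← map_sub]
      refine map_mem_of_span_image (BLin a) (fun m hm => ?_) (ih hl')
      rw [← HInt_cons]
      refine HInt_above_le k p (Submodule.subset_span ⟨_, ⟨SDom.cons (a : ℤ) hm, fun x hx => ?_⟩, rfl⟩)
      rcases List.mem_cons.1 hx with rfl | hx
      · exact_mod_cast ha
      · exact toInts_le m.2.2 x hx
    -- Membership ensures that `applyProj` takes its genuine branch and not the dummy value.
    have hmem : B a (kSchur k l) ∈ ΛB k := by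
      rw [← sub_add_cancel (B a (kSchur k l)) (HInt (toInts (a :: l)))]
      exact add_mem (span_HInt_le_ΛB k _ h1) (HInt_mem_ΛB p)
    have h2 : B a (kSchur k l) - kSplitPoly k (a :: l) ∈ Submodule.span A
        ((fun m : BPtn k => kSplitPoly k m.1) '' {m | PDom p m}) := by
      rw [← sub_add_sub_cancel _ (HInt (toInts (a :: l)))]
      exact add_mem ((unitri_HInt_kSplitPoly k).mem PDom.trans h1) (unitri_HInt_kSplitPoly k p)
    -- The leading term survives the projection because its first part is `a`; the error terms are
    -- kept or killed one by one.
    have h3 : kSchur k (a :: l) - kSplitPoly k (a :: l) ∈ Submodule.span A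
        ((fun m : BPtn k => kSplitPoly k m.1) '' {m | PDom p m}) := by
      have h4 := proj_mem a {m | PDom p m}
        (⟨B a (kSchur k l), hmem⟩ - ⟨kSplitPoly k (a :: l), kSplitPoly_mem_ΛB p⟩) h2
      have h5 := proj_kSplitPoly a p
      rw [if_pos (by rfl)] at h5
      rw [map_sub, Submodule.coe_sub, h5] at h4
      rw [kSchur, applyProj, dif_pos hmem]
      exact h4
    rw [← sub_add_sub_cancel _ (kSplitPoly k (a :: l))]
    exact add_mem ((unitri_kSplitPoly_HInt k).mem PDom.trans h3) (unitri_kSplitPoly_HInt k p)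

theorem kSchur_sub_schur (k : ℕ) (l : List ℕ) (hl : IsBounded k l) :
    kSchur k l - schur l ∈ Submodule.span A
      (schur '' ((partitionsOf l.sum).filter (fun m => StrictDom l m) : Finset (List ℕ))) := by
  let p : Ptn := ⟨l, hl.1⟩
  have h1 : kSchur k l - schur l ∈ Submodule.span A
      ((fun m : Ptn => schur m.1) '' {m | PDom p m}) := by
    rw [← sub_add_sub_cancel _ (HInt (toInts l))]
    refine add_mem (unitri_HInt_schur.mem PDom.trans ?_) (unitri_HInt_schur p)
    refine span_image_le (fun m hm => ?_) (kSchur_sub_HInt k l hl)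
    exact Submodule.subset_span ⟨⟨m.1, m.2.1⟩, hm, rfl⟩
  refine span_image_le (fun m hm => ?_) h1
  have h2 := (sDom_toInts hl.1 m.2).1 hm
  refine Submodule.subset_span ⟨m.1, ?_, rfl⟩
  rw [mem_coe, mem_filter, mem_partitionsOf]
  exact ⟨⟨m.2, h2.1.symm⟩, h2⟩

end

end KSchurFn

theorem mainTheorem4 (k : ℕ) (hk : 1 ≤ k) (lam : List ℕ) (hlam : KSchurFn.IsBounded k lam) :
    ∃ v : List ℕ → Polynomial ℤ,
      KSchurFn.kSchur k lam = KSchurFn.schur lam +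
        ∑ mu ∈ (KSchurFn.partitionsOf lam.sum).filter (fun mu => KSchurFn.StrictDom lam mu),
          (Polynomial.aeval KSchurFn.t (v mu) : KSchurFn.K) • KSchurFn.schur mu := by
  -- The coefficients lie in the image of `ℤ[t]` in `ℚ(t)`, so each lifts to an integer polynomial.
  obtain ⟨c, hc⟩ := (Submodule.mem_span_image_finset_iff_exists_fun' KSchurFn.A).1
    (KSchurFn.kSchur_sub_schur k lam hlam)
  have hA : ∀ mu, ∃ v : Polynomial ℤ, Polynomial.aeval KSchurFn.t v = (c mu : KSchurFn.K) :=
    fun mu => (c mu).2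
  choose v hv using hA
  refine ⟨v, ?_⟩
  rw [eq_comm, ← eq_sub_iff_add_eq', ← hc]
  refine Finset.sum_congr rfl fun mu _ => ?_
  rw [hv]
  rfl
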